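/- For $1\le i<j\le n$ let $a_{i,j}$ denote the positive band generator of the braid group $B_n$ joining the strands $i$ and $j$; it starts at strand $i$ and ends at strand $j$. A strongly quasipositive $n$-braid word is a finite product $w=\prod_k a_{i_k,j_k}$ of such generators. Its canonical surface is the oriented surface in $S^3$ consisting of $n$ discs, one for each strand, and of one positively twisted band for each letter, the band of $a_{i,j}$ joining the $i$-th disc to the $j$-th one and passing in front of the discs in between, with the bands placed in the order of the letters. (Explicitly: draw the strands as vertical arcs, and for each letter $a_{i,j}$, from bottom to top, an arc that leaves strand $i$ to the right, runs horizontally over the strands $i+1,\dots,j$, hooks upwards and meets strand $j$ from the right; the canonical surface is the blackboard-framed thickening of this graph, with its positive side facing the viewer.) Oriented surfaces in $S^3$ are considered up to orientation-preserving (topological) ambient isotopy. **Lemma.** Let $A\subset S^3$ be an embedded, bicollared, oriented annulus (for example, the zero-framed annulus of a non-trivial strongly quasipositive knot), and suppose that $A$ is ambient isotopic to the canonical surface of some strongly quasipositive braid word. Then there are an integer $m$ and a strongly quasipositive $m$-braid word $w_A$ such that the canonical surface of $w_A$ is ambient isotopic to $A$ and, for every strand $k\in\{1,\dots,m\}$,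 exactly two letters of $w_A$ start or end at strand $k$. In particular, exactly two letters of $w_A$ are of the form $a_{1,j}$. -/

import Mathlib

open Set Topology

/-- The generator `a_{i,j}`, `i < j`, of the braid group on `n` strands. Strands are numbered from
`0` here, so the first strand is `0 : Fin n`. The generator starts at strand `i` (`startStrand`) and ends
at strand `j` (`endStrand`). -/
structure BandGen (n : ℕ) where
  startStrand : Fin n
  endStrand : Fin n
  lt : startStrand < endStrand

/-- A strongly quasipositive `n`-braid word: a finite product of generators `a_{i,j}`. -/
abbrev SQPWord (n : ℕ) : Type := List (BandGen n)

/-- The number of letters of `w` that start or end at the strand `k`. -/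
def SQPWord.degree {n : ℕ} (w : SQPWord n) (k : Fin n) : ℕ :=
  w.countP fun g => decide (g.startStrand = k ∨ g.endStrand = k)

/-- The number of letters of `w` of the form `a_{1,j}`. -/
def SQPWord.numStartFirst {n : ℕ} (w : SQPWord n) : ℕ :=
  w.countP fun g => decide (g.startStrand.val = 0)

/-- The three-sphere, as `ℝ³ ∪ {∞}`. -/
abbrev S3 : Type := OnePoint (ℝ × ℝ × ℝ)

/-- A record of an oriented surface in the (oriented) three-sphere: the underlying set, and a set
that is the positive side of the surface in a neighbourhood of each of its interior points. Since
the three-sphere is oriented, a choice of side is the same as an orientation. -/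
structure SidedSet where
  carrier : Set S3
  side : Set S3

/-- Ambient isotopy of oriented surfaces in the three-sphere. The last clause says that the final
homeomorphism takes the positive side of `S` to the positive side of `T`, near the points of a dense
subset of `T` (near a boundary point of a surface the positive side is not well defined as a germ;
by continuity, agreement on a dense subset is agreement at all interior points). -/
def OrientedIsotopic (S T : SidedSet) : Prop :=
  ∃ H : C(unitInterval × S3, S3),
    (∀ p, H (0, p) = p) ∧
    (∀ t, IsHomeomorph fun p => H (t, p)) ∧
    (fun p => H (1, p)) '' S.carrier = T.carrier ∧
    T.carrier ⊆
      closure {q | q ∈ T.carrier ∧ ((fun p => H (1, p)) '' S.side : Set S3) =ᶠ[𝓝 q] T.side}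

/-- The disc of strand `k` (`k = 0, 1, …`), for a word with `m` letters: a vertical strip in the
plane of projection `z = 0`. -/
def strandDisc (m k : ℕ) : Set (ℝ × ℝ × ℝ) :=
  {p | 4 * (k : ℝ) ≤ p.1 ∧ p.1 ≤ 4 * k + 1 ∧ 0 ≤ p.2.1 ∧ p.2.1 ≤ 4 * (m : ℝ) + 1 ∧ p.2.2 = 0}

/-- The positive band from strand `i` to strand `j` (`i < j`) that belongs to letter number `l`: a
blackboard framed thickening of the arc that leaves strand `i` to the right, runs horizontally over
the strands `i + 1, …, j`, hooks upwards, and meets strand `j` from the right. -/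
def letterBand (l i j : ℕ) : Set (ℝ × ℝ × ℝ) :=
  -- the horizontal arm, lifted to height `z = 1` where it crosses strands
  {p | 4 * (i : ℝ) + 1 ≤ p.1 ∧ p.1 ≤ 4 * (j : ℝ) + 2 ∧
       4 * (l : ℝ) + 1 ≤ p.2.1 ∧ p.2.1 ≤ 4 * (l : ℝ) + 2 ∧
       p.2.2 = min 1 (min (p.1 - (4 * (i : ℝ) + 1)) (4 * (j : ℝ) + 2 - p.1))} ∪
  -- the vertical part of the hook
  {p | 4 * (j : ℝ) + 2 ≤ p.1 ∧ p.1 ≤ 4 * (j : ℝ) + 3 ∧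
       4 * (l : ℝ) + 1 ≤ p.2.1 ∧ p.2.1 ≤ 4 * (l : ℝ) + 4 ∧ p.2.2 = 0} ∪
  -- the return of the hook to strand `j`
  {p | 4 * (j : ℝ) + 1 ≤ p.1 ∧ p.1 ≤ 4 * (j : ℝ) + 2 ∧
       4 * (l : ℝ) + 3 ≤ p.2.1 ∧ p.2.1 ≤ 4 * (l : ℝ) + 4 ∧ p.2.2 = 0}

/-- The canonical surface in `ℝ³` of a strongly quasipositive word: one disc for each strand and one
positive band for each letter, the letters being placed from bottom to top. -/
def canonicalSet {n : ℕ} (w : SQPWord n) : Set (ℝ × ℝ × ℝ) :=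
  (⋃ k : Fin n, strandDisc w.length k) ∪
    ⋃ l : Fin w.length, letterBand l (w.get l).startStrand (w.get l).endStrand

/-- The canonical surface of a strongly quasipositive word as an oriented surface in the
three-sphere. The surface projects to the plane `z = 0` by an immersion, and its positive side is
the one that faces the viewer, who looks down the `z`-axis. -/
def canonicalSurface {n : ℕ} (w : SQPWord n) : SidedSet where
  carrier := (fun p : ℝ × ℝ × ℝ => (p : S3)) '' canonicalSet w
  side := (fun p : ℝ × ℝ × ℝ => (p : S3)) ''
    {p | ∃ z, (p.1, p.2.1, z) ∈ canonicalSet w ∧ z < p.2.2 ∧ p.2.2 < z + 1 / 2}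

/-- An embedded oriented annulus in the three-sphere, together with a bicollar: an embedding of
`S¹ × [0,1] × [-1,1]`. The annulus is the image of `S¹ × [0,1] × {0}`, and its positive side is the
image of `S¹ × [0,1] × (0,1]`. -/
structure OrientedAnnulus where
  toFun : Circle × unitInterval × Icc (-1 : ℝ) 1 → S3
  isEmbedding : IsEmbedding toFun

/-- The oriented surface underlying an annulus with a bicollar. -/
def OrientedAnnulus.surface (A : OrientedAnnulus) : SidedSet where
  carrier := A.toFun '' {p | (p.2.2 : ℝ) = 0}
  side := A.toFun '' {p | 0 < (p.2.2 : ℝ)}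

/-- The annulus `A` arises as the canonical surface of the strongly quasipositive word `w`. -/
def IsCanonicalSurfaceOf {n : ℕ} (A : OrientedAnnulus) (w : SQPWord n) : Prop :=
  OrientedIsotopic (canonicalSurface w) A.surface

/-!
The strands and letters of a strongly quasipositive word are the vertices and edges of a graph, onto
which its canonical surface retracts. If the surface is an annulus, this graph is connected and has
as many edges as vertices, so it consists of a cycle with trees attached to it. Removing the leaves
of the trees one after the other leaves the cycle, in which all vertices have degree two. The proof
is therefore an induction on the number of strands, with two ingredients.

*Removing a leaf* (`exists_surfEquiv_of_degree_eq_one`). If a strand is met by exactly one letter,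
its disc and the band of this letter form a disc that is attached to the rest of the surface along an
arc, and this disc can be collapsed by an ambient isotopy. Isotopies are obtained from maps
`p ↦ p + g p • v` that move points along a fixed direction `v` and are increasing on each line
parallel to `v` (`SurfEquiv.push`). Such a map collapses a flat triangle onto its base
(`SurfEquiv.collapse_triangle`), two of them collapse a rectangle attached along a side
(`SurfEquiv.collapse_rectangle`), and the leaf is a union of five rectangles
(`SurfEquiv.collapse_end`, `SurfEquiv.collapse_start`). The arm of the band, which is not flat and
passes over other discs, is made flat by a vertical shear. All isotopies used take the points just
above the surface to the points just above its image, so the orientation is respected. Finally two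
piecewise linear reparametrizations, one of each horizontal axis, close the gaps.

*Counting* (`length_le_of_homeomorph_annulus`, `degree_ne_zero_of_homeomorph_annulus`). The surface
carries, for each integral cochain `c` on the letters, a map to the circle that winds `c l` times
along the band of the letter `l`. It lifts to the line only if `c` is a coboundary. On an annulus any
two maps to the circle have a nontrivial combination that lifts, so the cokernel of the coboundary map
has rank at most one. The coboundary map kills the constants, whence there are at most as many letters
as strands. Moreover no strand has degree zero, since otherwise the surface would be a single
disc, on which all maps to the circle lift. If no strand has degree one either, then all degrees are at
least two, their sum is twice the number of letters, and so all of them are equal to two.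
-/

/-! ### Ambient isotopies of the three-sphere -/

/-- `F` is the final map of an ambient isotopy of the three-sphere. -/
def IsotopicToId (F : S3 → S3) : Prop :=
  ∃ H : C(unitInterval × S3, S3), (∀ p, H (0, p) = p) ∧
    (∀ t, IsHomeomorph fun p => H (t, p)) ∧ ∀ p, H (1, p) = F p

namespace IsotopicToId

theorem isHomeomorph {F : S3 → S3} (hF : IsotopicToId F) : IsHomeomorph F := by
  obtain ⟨H, -, h, h1⟩ := hF
  have := h 1
  rwa [funext h1] at this

theorem id : IsotopicToId _root_.id :=
  ⟨⟨fun p => p.2, continuous_snd⟩, fun _ => rfl, fun _ => IsHomeomorph.id, fun _ => rfl⟩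

theorem comp {F G : S3 → S3} (hG : IsotopicToId G) (hF : IsotopicToId F) :
    IsotopicToId (G ∘ F) := by
  obtain ⟨H, h0, h, h1⟩ := hF
  obtain ⟨K, k0, k, k1⟩ := hG
  refine ⟨⟨fun p => K (p.1, H p), by fun_prop⟩, fun p => ?_, fun t => ?_, fun p => ?_⟩
  · simp [h0, k0]
  · exact (k t).comp (h t)
  · simp [h1, k1]

/-- The inverse of the final map is reached by running the isotopy backwards from it. -/
theorem exists_inverse {F : S3 → S3} (hF : IsotopicToId F) :
    ∃ G, IsotopicToId G ∧ (∀ p, G (F p) = p) ∧ ∀ p, F (G p) = p := by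
  have hh := hF.isHomeomorph
  set e : S3 ≃ₜ S3 := hh.homeomorph with he
  have heF : ∀ p, e p = F p := fun p => rfl
  obtain ⟨H, h0, h, h1⟩ := hF
  refine ⟨e.symm, ⟨⟨fun p => H (unitInterval.symm p.1, e.symm p.2), by fun_prop⟩, fun p => ?_,
    fun t => ?_, fun p => ?_⟩, fun p => ?_, fun p => ?_⟩
  · simp [h1, ← heF]
  · exact (h (unitInterval.symm t)).comp e.symm.isHomeomorph
  · simp [h0]
  · rw [← heF, e.symm_apply_apply]
  · rw [← heF, e.apply_symm_apply]

end IsotopicToId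

/-- The set of the points at height less than `1 / 2` above the set `X`. For a surface that projects
to the plane by an immersion it is the positive side. -/
def upperSide (X : Set (ℝ × ℝ × ℝ)) : Set (ℝ × ℝ × ℝ) :=
  {p | ∃ z, (p.1, p.2.1, z) ∈ X ∧ z < p.2.2 ∧ p.2.2 < z + 1 / 2}

/-- An ambient isotopy takes `X` to `Y` and the points just above `X` to those just above `Y`.
In contrast to `OrientedIsotopic`, the sides are required to agree everywhere. -/
def SurfEquiv (X Y : Set (ℝ × ℝ × ℝ)) : Prop :=
  ∃ F : S3 → S3, IsotopicToId F ∧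
    F '' ((fun p : ℝ × ℝ × ℝ => (p : S3)) '' X) = (fun p : ℝ × ℝ × ℝ => (p : S3)) '' Y ∧
    F '' ((fun p : ℝ × ℝ × ℝ => (p : S3)) '' upperSide X) =
      (fun p : ℝ × ℝ × ℝ => (p : S3)) '' upperSide Y

namespace SurfEquiv

variable {X Y Z : Set (ℝ × ℝ × ℝ)}

theorem refl (X : Set (ℝ × ℝ × ℝ)) : SurfEquiv X X :=
  ⟨id, IsotopicToId.id, by simp, by simp⟩

theorem symm (h : SurfEquiv X Y) : SurfEquiv Y X := by
  obtain ⟨F, hF, h1, h2⟩ := h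
  obtain ⟨G, hG, hGF, -⟩ := hF.exists_inverse
  have key : ∀ A : Set S3, G '' (F '' A) = A := fun A => by
    rw [image_image]; simp [hGF]
  exact ⟨G, hG, by rw [← h1, key], by rw [← h2, key]⟩

theorem trans (h : SurfEquiv X Y) (h' : SurfEquiv Y Z) : SurfEquiv X Z := by
  obtain ⟨F, hF, h1, h2⟩ := h
  obtain ⟨G, hG, h3, h4⟩ := h'
  exact ⟨G ∘ F, hG.comp hF, by rw [image_comp, h1, h3], by rw [image_comp, h2, h4]⟩

theorem orientedIsotopic {n m : ℕ} {v : SQPWord n} {w : SQPWord m} {T : SidedSet}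
    (h : SurfEquiv (canonicalSet v) (canonicalSet w))
    (hw : OrientedIsotopic (canonicalSurface w) T) :
    OrientedIsotopic (canonicalSurface v) T := by
  obtain ⟨F, ⟨K, k0, k, k1⟩, h1, h2⟩ := h
  obtain ⟨H, h0, hh, hc, hs⟩ := hw
  have key : ∀ A : Set S3, (fun p => H (1, K (1, p))) '' A = (fun p => H (1, p)) '' (F '' A) := by
    intro A; rw [image_image]; simp [k1]
  refine ⟨⟨fun p => H (p.1, K p), by fun_prop⟩, fun p => ?_, fun t => ?_, ?_, ?_⟩
  · simp [h0, k0]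
  · exact (hh t).comp (k t)
  · refine (key _).trans ?_
    rw [← hc]
    exact congrArg _ h1
  · have : (fun p => H (1, K (1, p))) '' (canonicalSurface v).side =
        (fun p => H (1, p)) '' (canonicalSurface w).side :=
      (key _).trans (congrArg _ h2)
    simp only [ContinuousMap.coe_mk]
    rw [this]
    exact hs

end SurfEquiv

/-! ### Pushes along a direction -/

/-- A bounded continuous displacement of `ℝ³` extends continuously by `∞ ↦ ∞`, also with
parameters. -/
theorem continuous_onePoint_map_of_bounded {h : unitInterval × (ℝ × ℝ × ℝ) → ℝ × ℝ × ℝ}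
    (hc : Continuous h) {C : ℝ} (hb : ∀ t p, dist (h (t, p)) p ≤ C) :
    Continuous fun q : unitInterval × S3 => OnePoint.map (fun p => h (q.1, p)) q.2 := by
  rw [continuous_iff_continuousAt]
  rintro ⟨t, p⟩
  induction p using OnePoint.rec with
  | coe p =>
    have hemb : IsOpenEmbedding (Prod.map id (fun p : ℝ × ℝ × ℝ => (p : S3)) :
        unitInterval × (ℝ × ℝ × ℝ) → unitInterval × S3) :=
      IsOpenEmbedding.id.prodMap OnePoint.isOpenEmbedding_coe
    have : (t, (p : S3)) = Prod.map id (fun p : ℝ × ℝ × ℝ => (p : S3)) (t, p) := rfl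
    rw [this, ← hemb.continuousAt_iff]
    exact (OnePoint.continuous_coe.comp hc).continuousAt
  | infty =>
    rw [ContinuousAt, OnePoint.map_infty, OnePoint.hasBasis_nhds_infty.tendsto_right_iff]
    rintro K ⟨hK1, hK2⟩
    have hK' : IsCompact (Metric.cthickening C K) := hK2.cthickening
    have hopen : ((fun p : ℝ × ℝ × ℝ => (p : S3)) '' (Metric.cthickening C K)ᶜ ∪ {OnePoint.infty}) ∈
        𝓝 (OnePoint.infty : S3) :=
      OnePoint.hasBasis_nhds_infty.mem_of_mem ⟨hK'.isClosed, hK'⟩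
    rw [nhds_prod_eq]
    filter_upwards [Filter.prod_mem_prod Filter.univ_mem hopen]
    rintro ⟨s, q⟩ ⟨-, hq⟩
    rcases hq with ⟨q, hq, rfl⟩ | hq
    · refine Or.inl ⟨h (s, q), fun hmem => hq ?_, rfl⟩
      exact Metric.mem_cthickening_of_dist_le q _ C K hmem (by rw [dist_comm]; exact hb s q)
    · simp only [mem_singleton_iff] at hq
      subst hq
      exact Or.inr rfl

/-- A displacement along the lines parallel to `v` that is increasing on each of these lines is
bijective. -/
theorem bijective_push {v : ℝ × ℝ × ℝ} {g : ℝ × ℝ × ℝ → ℝ} (hg : Continuous g) {C : ℝ}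
    (hC : ∀ p, |g p| ≤ C) (hmono : ∀ p, StrictMono fun s : ℝ => s + g (p + s • v)) :
    Function.Bijective fun p => p + g p • v := by
  constructor
  · intro p q hpq
    have hq : q = p + (g p - g q) • v := by
      simp only at hpq
      rw [sub_smul, ← add_sub_assoc, hpq, add_sub_cancel_right]
    have h0 : (g p - g q) + g (p + (g p - g q) • v) = 0 + g (p + (0 : ℝ) • v) := by
      rw [← hq]; simp
    have := (hmono p).injective h0
    rw [hq, this]; simp
  · intro p
    have hcont : Continuous fun s : ℝ => s + g (p + s • v) := by fun_prop
    have h1 : (fun s : ℝ => s + g (p + s • v)) (-C) ≤ 0 := by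
      have := (abs_le.mp (hC (p + (-C) • v))).2
      simp only; linarith
    have h2 : 0 ≤ (fun s : ℝ => s + g (p + s • v)) C := by
      have := (abs_le.mp (hC (p + C • v))).1
      simp only; linarith
    obtain ⟨s, hs⟩ := mem_range_of_exists_le_of_exists_ge hcont ⟨_, h1⟩ ⟨_, h2⟩
    refine ⟨p + s • v, ?_⟩
    simp only at hs ⊢
    rw [add_assoc, ← add_smul, hs, zero_smul, add_zero]

theorem isotopicToId_push {v : ℝ × ℝ × ℝ} {g : ℝ × ℝ × ℝ → ℝ} (hg : Continuous g) {C : ℝ}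
    (hC : ∀ p, |g p| ≤ C) (hmono : ∀ p, StrictMono fun s : ℝ => s + g (p + s • v)) :
    IsotopicToId (OnePoint.map fun p => p + g p • v) := by
  have hC0 : 0 ≤ C := (abs_nonneg _).trans (hC 0)
  have hcont : Continuous fun q : unitInterval × S3 =>
      OnePoint.map (fun p => p + ((q.1 : ℝ) * g p) • v) q.2 := by
    refine continuous_onePoint_map_of_bounded
      (h := fun q => q.2 + ((q.1 : ℝ) * g q.2) • v) (by fun_prop) (C := C * ‖v‖) fun t p => ?_
    simp only [dist_self_add_left, norm_smul, Real.norm_eq_abs, abs_mul]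
    gcongr
    rw [abs_of_nonneg t.2.1]
    exact (mul_le_of_le_one_left (abs_nonneg _) t.2.2).trans (hC p)
  refine ⟨⟨_, hcont⟩, fun p => ?_, fun t => ?_, fun p => ?_⟩
  · induction p using OnePoint.rec <;> simp
  · have hbij : Function.Bijective fun p : ℝ × ℝ × ℝ => p + ((t : ℝ) * g p) • v := by
      refine bijective_push (C := C) (by fun_prop) (fun p => ?_) fun p => ?_
      · rw [abs_mul, abs_of_nonneg t.2.1]
        exact (mul_le_of_le_one_left (abs_nonneg _) t.2.2).trans (hC p)
      · intro a b hab
        have := hmono p hab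
        simp only at this ⊢
        rcases eq_or_lt_of_le t.2.1 with h | h
        · rw [← h]; simpa using hab
        · nlinarith [mul_lt_mul_of_pos_left this h, t.2.2]
    refine isHomeomorph_iff_continuous_bijective.mpr ⟨?_, ?_, ?_⟩
    · exact hcont.comp (Continuous.prodMk_right t)
    · exact Option.map_injective hbij.1
    · intro q
      induction q using OnePoint.rec with
      | infty => exact ⟨OnePoint.infty, rfl⟩
      | coe q =>
        obtain ⟨p, hp⟩ := hbij.2 q
        exact ⟨p, congrArg _ hp⟩
  · simp

/-- A push that moves the points just above `X` like the points of `X` does not change the isotopy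
class of the surface. -/
theorem SurfEquiv.push {X : Set (ℝ × ℝ × ℝ)} (v : ℝ × ℝ × ℝ) (g : ℝ × ℝ × ℝ → ℝ)
    (hg : Continuous g) {C : ℝ}
    (hC : ∀ p, |g p| ≤ C) (hmono : ∀ p, StrictMono fun s : ℝ => s + g (p + s • v))
    (hup : ∀ p ∈ X, ∀ r : ℝ, 0 < r → r < 1 / 2 → g (p.1, p.2.1, p.2.2 + r) = g p) :
    SurfEquiv X ((fun p => p + g p • v) '' X) := by
  refine ⟨_, isotopicToId_push hg hC hmono, ?_, ?_⟩
  · rw [image_image, image_image]; simp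
  · rw [image_image]
    simp only [OnePoint.map_some]
    rw [← image_image (fun p : ℝ × ℝ × ℝ => (p : S3)) (fun p => p + g p • v)]
    congr 1
    ext q
    constructor
    · rintro ⟨⟨x, y, z⟩, ⟨z', hz', h1, h2⟩, rfl⟩
      simp only at hz' h1 h2
      have := hup _ hz' (z - z') (by linarith) (by linarith)
      simp only [add_sub_cancel] at this
      refine ⟨z' + g (x, y, z') * v.2.2, ⟨_, hz', ?_⟩, ?_, ?_⟩
      · ext <;> simp [this]
      · simp [this, h1]
      · simp [this]; linarith
    · rintro ⟨z', ⟨⟨x, y, z⟩, hp, hq⟩, h1, h2⟩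
      obtain ⟨a, b, c⟩ := q
      have ha : x + g (x, y, z) * v.1 = a := congrArg (fun p => p.1) hq
      have hb : y + g (x, y, z) * v.2.1 = b := congrArg (fun p => p.2.1) hq
      have hc : z + g (x, y, z) * v.2.2 = z' := congrArg (fun p => p.2.2) hq
      rw [← hc] at h1 h2
      change z + g (x, y, z) * v.2.2 < c at h1
      change c < z + g (x, y, z) * v.2.2 + 1 / 2 at h2
      have := hup _ hp (c - (z + g (x, y, z) * v.2.2)) (by linarith) (by linarith)
      simp only at this
      refine ⟨(x, y, z + (c - (z + g (x, y, z) * v.2.2))), ⟨z, hp, ?_, ?_⟩, ?_⟩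
      · simp only; linarith
      · simp only; linarith
      · simp only [this]
        ext
        · simp [ha]
        · simp [hb]
        · simp only [Prod.snd_add, Prod.smul_snd, smul_eq_mul]
          ring

/-! ### Collapsing triangles and rectangles -/

/-- The amount by which a point at height `s` is pushed down when the interval `[-εd, d]` is
compressed to `[-εd, 0]` and the interval `[d, (1 + μ)d]` is stretched to `[0, (1 + μ)d]`. -/
noncomputable def compression (ε μ d s : ℝ) : ℝ :=
  max 0 (min ((s + ε * d) / (1 + ε)) (((1 + μ) * d - s) / μ))

theorem compression_nonneg (ε μ d s : ℝ) : 0 ≤ compression ε μ d s := le_max_left _ _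

section compression

variable {ε μ d s : ℝ} (hε : 0 < ε) (hμ : 0 < μ)
include hε hμ

theorem compression_le (hd : d ≤ 1) : compression ε μ d s ≤ 1 := by
  refine max_le zero_le_one ?_
  rcases le_total s d with h | h
  · refine (min_le_left _ _).trans ?_
    rw [div_le_iff₀ (by positivity)]
    nlinarith
  · refine (min_le_right _ _).trans ?_
    rw [div_le_iff₀ hμ]
    nlinarith

theorem lt_of_compression_ne_zero (h : compression ε μ d s ≠ 0) :
    0 < d ∧ -(ε * d) < s ∧ s < (1 + μ) * d := by
  have hpos : 0 < compression ε μ d s := lt_of_le_of_ne (compression_nonneg _ _ _ _) h.symm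
  rw [compression, lt_max_iff, lt_min_iff] at hpos
  have h1 : 0 < (s + ε * d) / (1 + ε) ∧ 0 < ((1 + μ) * d - s) / μ := by simpa using hpos
  have h2 : 0 < s + ε * d := by
    have := mul_pos h1.1 (show 0 < 1 + ε by positivity)
    rwa [div_mul_cancel₀ _ (by positivity)] at this
  have h3 : 0 < (1 + μ) * d - s := by
    have := mul_pos h1.2 hμ
    rwa [div_mul_cancel₀ _ (by positivity)] at this
  refine ⟨?_, by linarith, by linarith⟩
  by_contra hd
  nlinarith

theorem compression_of_mem (h1 : -(ε * d) ≤ s) (h2 : s ≤ d) :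
    compression ε μ d s = (s + ε * d) / (1 + ε) := by
  have h3 : (s + ε * d) / (1 + ε) ≤ ((1 + μ) * d - s) / μ := by
    rw [div_le_div_iff₀ (by positivity) hμ]
    nlinarith [mul_nonneg hε.le (sub_nonneg.2 h2), mul_nonneg hμ.le (sub_nonneg.2 h2)]
  rw [compression, min_eq_left h3, max_eq_right]
  exact div_nonneg (by linarith) (by positivity)

theorem compression_sub_le {t : ℝ} (h : s ≤ t) :
    compression ε μ d t - compression ε μ d s ≤ (t - s) / (1 + ε) := by
  have h0 : 0 ≤ (t - s) / (1 + ε) := div_nonneg (by linarith) (by positivity)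
  have h1 : (t + ε * d) / (1 + ε) = (s + ε * d) / (1 + ε) + (t - s) / (1 + ε) := by ring
  have h2 : ((1 + μ) * d - t) / μ ≤ ((1 + μ) * d - s) / μ := by gcongr
  rw [sub_le_iff_le_add, compression, compression, h1]
  refine max_le (add_nonneg h0 (le_max_left _ _)) ?_
  rcases le_total ((s + ε * d) / (1 + ε)) (((1 + μ) * d - s) / μ) with h3 | h3
  · rw [min_eq_left h3]
    refine (min_le_left _ _).trans ?_
    linarith [le_max_right 0 ((s + ε * d) / (1 + ε))]
  · rw [min_eq_right h3]
    refine (min_le_right _ _).trans ?_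
    linarith [le_max_right 0 (((1 + μ) * d - s) / μ)]

end compression

/-- The cut-off function that is `1` on `[0, 1/2]` and vanishes outside `(-1/2, 1)`. -/
noncomputable def heightCutoff (z : ℝ) : ℝ := max 0 (min 1 (min (2 * z + 1) (2 - 2 * z)))

theorem continuous_heightCutoff : Continuous heightCutoff := by
  unfold heightCutoff; fun_prop

theorem heightCutoff_nonneg (z : ℝ) : 0 ≤ heightCutoff z := le_max_left _ _

theorem heightCutoff_le_one (z : ℝ) : heightCutoff z ≤ 1 :=
  max_le zero_le_one (min_le_left _ _)

theorem heightCutoff_eq_one {z : ℝ} (h0 : 0 ≤ z) (h1 : z ≤ 1 / 2) : heightCutoff z = 1 := by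
  rw [heightCutoff, min_eq_left, max_eq_right zero_le_one]
  exact le_min (by linarith) (by linarith)

theorem heightCutoff_eq_zero {z : ℝ} (h : z ≤ -1 / 2 ∨ 1 ≤ z) : heightCutoff z = 0 := by
  rw [heightCutoff, max_eq_left]
  rcases h with h | h
  · exact (min_le_right _ _).trans ((min_le_left _ _).trans (by linarith))
  · exact (min_le_right _ _).trans ((min_le_right _ _).trans (by linarith))

/-- A flat triangle that is attached to a surface along its base, and meets it nowhere else, may be
removed. The functions `S` and `U` are the coordinates along the altitude `v` and along the base, on
which `U` runs from `-1` to `1`; the triangle is `0 < S ≤ 1 - |U|`. Below its base the surface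
contains a flat triangle of height `ε`, into which the triangle is compressed; above it there is room
up to the height `1 + μ`. -/
theorem SurfEquiv.collapse_triangle {Y : Set (ℝ × ℝ × ℝ)} (U S : ℝ → ℝ → ℝ)
    (hU : Continuous fun p : ℝ × ℝ => U p.1 p.2) (hS : Continuous fun p : ℝ × ℝ => S p.1 p.2)
    (v₁ v₂ : ℝ) (hUv : ∀ x y t, U (x + t * v₁) (y + t * v₂) = U x y)
    (hSv : ∀ x y t, S (x + t * v₁) (y + t * v₂) = S x y + t)
    {ε μ : ℝ} (hε : 0 < ε) (hμ : 0 < μ)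
    (habove : ∀ x y z, (x, y, z) ∈ Y → 0 < S x y → S x y < (1 + μ) * (1 - |U x y|) →
      z ≤ -1 ∨ 1 ≤ z)
    (hbelow : ∀ x y z, (x, y, z) ∈ Y → 0 < 1 - |U x y| → -(ε * (1 - |U x y|)) < S x y → S x y ≤ 0 →
      z = 0 ∨ z ≤ -1 ∨ 1 ≤ z)
    (hbase : ∀ x y, 0 < 1 - |U x y| → -(ε * (1 - |U x y|)) ≤ S x y → S x y ≤ 0 → (x, y, 0) ∈ Y) :
    SurfEquiv (Y ∪ {p | 0 < S p.1 p.2.1 ∧ S p.1 p.2.1 ≤ 1 - |U p.1 p.2.1| ∧ p.2.2 = 0}) Y := by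
  set T : Set (ℝ × ℝ × ℝ) :=
    {p | 0 < S p.1 p.2.1 ∧ S p.1 p.2.1 ≤ 1 - |U p.1 p.2.1| ∧ p.2.2 = 0} with hT
  set c : ℝ → ℝ → ℝ := fun x y => compression ε μ (1 - |U x y|) (S x y) with hc
  have hccont : Continuous fun p : ℝ × ℝ => c p.1 p.2 := by
    simp only [hc, compression]
    fun_prop
  have hc0 : ∀ x y, 0 ≤ c x y := fun x y => compression_nonneg _ _ _ _
  have hc1 : ∀ x y, c x y ≤ 1 := fun x y =>
    compression_le hε hμ (by linarith [abs_nonneg (U x y)])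
  set g : ℝ × ℝ × ℝ → ℝ := fun p => -(heightCutoff p.2.2 * c p.1 p.2.1) with hg
  have hgcont : Continuous g := by
    have h1 : Continuous fun p : ℝ × ℝ × ℝ => c p.1 p.2.1 :=
      hccont.comp (by fun_prop : Continuous fun p : ℝ × ℝ × ℝ => (p.1, p.2.1))
    have h2 := continuous_heightCutoff
    fun_prop
  have hfix : ∀ x y z, g (x, y, z) ≠ 0 → 0 < 1 - |U x y| ∧ -(ε * (1 - |U x y|)) < S x y ∧
      S x y < (1 + μ) * (1 - |U x y|) := fun x y z h =>
    lt_of_compression_ne_zero hε hμ fun h0 => h (by simp [hg, hc, h0])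
  have hfix' : ∀ x y z, (x, y, z) ∈ Y → g (x, y, z) ≠ 0 → z = 0 ∧ 0 < 1 - |U x y| ∧
      -(ε * (1 - |U x y|)) < S x y ∧ S x y ≤ 0 := by
    intro x y z hY h
    obtain ⟨h1, h2, h3⟩ := hfix x y z h
    have hz : ¬ (z ≤ -1 ∨ 1 ≤ z) := fun hz => h <| by
      simp only [hg]
      rw [heightCutoff_eq_zero (hz.imp_left fun h => by linarith)]
      simp
    have hS0 : S x y ≤ 0 := not_lt.1 fun hS0 => hz (habove x y z hY hS0 h3)
    exact ⟨(hbelow x y z hY h1 h2 hS0).resolve_right hz, h1, h2, hS0⟩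
  have hg0 : ∀ x y, -(ε * (1 - |U x y|)) ≤ S x y → S x y ≤ 1 - |U x y| →
      g (x, y, 0) = -((S x y + ε * (1 - |U x y|)) / (1 + ε)) := by
    intro x y h1 h2
    simp only [hg, hc]
    rw [heightCutoff_eq_one le_rfl (by norm_num), one_mul, compression_of_mem hε hμ h1 h2]
  have key : (fun p => p + g p • ((v₁, v₂, 0) : ℝ × ℝ × ℝ)) '' (Y ∪ T) = Y := by
    have hpush : ∀ x y z, (x, y, z) + g (x, y, z) • ((v₁, v₂, 0) : ℝ × ℝ × ℝ) =
        (x + g (x, y, z) * v₁, y + g (x, y, z) * v₂, z) := by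
      intro x y z; ext <;> simp
    -- points of `Y ∪ T` between the two apices are moved into the lower triangle
    have hmem : ∀ x y, 0 < 1 - |U x y| → -(ε * (1 - |U x y|)) ≤ S x y → S x y ≤ 1 - |U x y| →
        (x + g (x, y, 0) * v₁, y + g (x, y, 0) * v₂, (0 : ℝ)) ∈ Y := by
      intro x y h1 h2 h3
      have e : S x y + g (x, y, 0) = ε * (S x y - (1 - |U x y|)) / (1 + ε) := by
        rw [hg0 x y h2 h3]; field_simp; ring
      refine hbase _ _ ?_ ?_ ?_
      · rwa [hUv]
      · rw [hUv, hSv, e, le_div_iff₀ (by positivity)]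
        nlinarith
      · rw [hSv, e]
        exact div_nonpos_of_nonpos_of_nonneg (by nlinarith) (by positivity)
    ext ⟨x, y, z⟩
    constructor
    · rintro ⟨⟨x', y', z'⟩, hp | ⟨h1, h2, h3⟩, hq⟩
      · simp only [hpush] at hq
        by_cases h : g (x', y', z') = 0
        · rw [h] at hq
          simpa [← hq] using hp
        · obtain ⟨rfl, h1, h2, h3⟩ := hfix' _ _ _ hp h
          rw [← hq]
          exact hmem _ _ h1 h2.le (by linarith)
      · simp only at h1 h2 h3
        subst h3
        simp only [hpush] at hq
        rw [← hq]
        exact hmem _ _ (by linarith) (by nlinarith) h2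
    · intro hp
      by_cases h : g (x, y, z) = 0
      · exact ⟨_, Or.inl hp, by simp [h]⟩
      · obtain ⟨rfl, h1, h2, h3⟩ := hfix' _ _ _ hp h
        -- the inverse of the compression
        set t := S x y / ε + (1 - |U x y|) with ht
        have htS : -(ε * (1 - |U x y|)) ≤ S x y + t := by
          have : -(1 - |U x y|) ≤ S x y / ε := by
            rw [le_div_iff₀ hε]; linarith
          linarith
        have htS' : S x y + t ≤ 1 - |U x y| := by
          have : S x y / ε ≤ 0 := div_nonpos_of_nonpos_of_nonneg h3 hε.le
          linarith
        refine ⟨(x + t * v₁, y + t * v₂, 0), ?_, ?_⟩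
        · by_cases h4 : 0 < S x y + t
          · right
            exact ⟨by simpa [hSv] using h4, by simpa [hSv, hUv] using htS', rfl⟩
          · left
            exact hbase _ _ (by rwa [hUv]) (by rwa [hUv, hSv]) (by rw [hSv]; linarith)
        · have e : g (x + t * v₁, y + t * v₂, 0) = -t := by
            rw [hg0 _ _ (by rwa [hUv, hSv]) (by rwa [hUv, hSv]), hUv, hSv, ht]
            field_simp; ring
          simp only [e]
          ext <;> simp
  have := SurfEquiv.push (X := Y ∪ T) (v₁, v₂, 0) g hgcont (C := 1) ?_ ?_ ?_
  · rwa [key] at this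
  · intro p
    rw [hg, abs_neg, abs_of_nonneg (mul_nonneg (heightCutoff_nonneg _) (hc0 _ _))]
    exact mul_le_one₀ (heightCutoff_le_one _) (hc0 _ _) (hc1 _ _)
  · rintro ⟨x, y, z⟩ s t hst
    have e : ∀ s : ℝ, g ((x, y, z) + s • ((v₁, v₂, 0) : ℝ × ℝ × ℝ)) =
        -(heightCutoff z * compression ε μ (1 - |U x y|) (S x y + s)) := by
      intro s; simp [hg, hc, hUv, hSv]
    simp only [e]
    have h1 := compression_sub_le hε hμ (d := 1 - |U x y|) (show S x y + s ≤ S x y + t by linarith)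
    have h2 : (S x y + t - (S x y + s)) / (1 + ε) < t - s := by
      rw [div_lt_iff₀ (by positivity)]; nlinarith
    have h3 := heightCutoff_nonneg z
    have h4 := heightCutoff_le_one z
    set a := compression ε μ (1 - |U x y|) (S x y + s)
    set b := compression ε μ (1 - |U x y|) (S x y + t)
    have h5 : heightCutoff z * (b - a) < t - s := by
      rcases le_total (b - a) 0 with h | h
      · exact (mul_nonpos_of_nonneg_of_nonpos h3 h).trans_lt (sub_pos.2 hst)
      · exact (mul_le_of_le_one_left h h4).trans_lt (h1.trans_lt h2)
    linarith
  · rintro ⟨x, y, z⟩ hp r hr0 hr1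
    have hz : c x y ≠ 0 → z = 0 ∨ z ≤ -1 ∨ 1 ≤ z := by
      intro h
      obtain ⟨h1, h2, h3⟩ := lt_of_compression_ne_zero hε hμ h
      rcases hp with hp | hp
      · rcases lt_or_ge 0 (S x y) with h4 | h4
        · exact Or.inr (habove _ _ _ hp h4 h3)
        · exact hbelow _ _ _ hp h1 h2 h4
      · exact Or.inl hp.2.2
    by_cases h : c x y = 0
    · simp [hg, h]
    · simp only [hg]
      rcases hz h with rfl | h5
      · rw [heightCutoff_eq_one le_rfl (by norm_num), heightCutoff_eq_one (by linarith) (by linarith)]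
      · rw [heightCutoff_eq_zero (z := z) (h5.imp_left fun h => by linarith),
          heightCutoff_eq_zero (z := z + r)
            (h5.imp (fun h => by linarith) fun h => by linarith)]

/-- Shearing a surface vertically does not change its isotopy class. -/
theorem SurfEquiv.shear (X : Set (ℝ × ℝ × ℝ)) (f : ℝ → ℝ → ℝ)
    (hf : Continuous fun p : ℝ × ℝ => f p.1 p.2) {C : ℝ} (hC : ∀ x y, |f x y| ≤ C) :
    SurfEquiv X {p | (p.1, p.2.1, p.2.2 + f p.1 p.2.1) ∈ X} := by
  have hcont : Continuous fun p : ℝ × ℝ × ℝ => -f p.1 p.2.1 :=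
    (hf.comp (by fun_prop : Continuous fun p : ℝ × ℝ × ℝ => (p.1, p.2.1))).neg
  have := SurfEquiv.push (X := X) (0, 0, 1) (fun p => -f p.1 p.2.1) hcont (C := C)
    (fun p => by rw [abs_neg]; exact hC _ _) (fun p s t hst => by simpa using hst)
    (fun p _ r _ _ => rfl)
  convert this using 1
  ext ⟨x, y, z⟩
  constructor
  · intro h
    exact ⟨_, h, by ext <;> simp⟩
  · rintro ⟨⟨x', y', z'⟩, h, hq⟩
    have h1 : x' = x := by simpa using congrArg (fun p => p.1) hq
    have h2 : y' = y := by simpa using congrArg (fun p => p.2.1) hq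
    have h3 : z' + -f x' y' = z := by simpa using congrArg (fun p => p.2.2) hq
    subst h1 h2
    simpa [← h3] using h

theorem le_one_sub_abs_iff {a b : ℝ} : a ≤ 1 - |b| ↔ a + b ≤ 1 ∧ a - b ≤ 1 := by
  rw [le_sub_comm, abs_le]
  constructor <;> rintro ⟨h1, h2⟩ <;> constructor <;> linarith

/-- A flat rectangle `[0, 1] × (0, L]` that is attached to a surface along the side `s = 0`, and
meets it nowhere else, may be removed: first the half of the rectangle above the diagonal, then the
other half. -/
theorem SurfEquiv.collapse_flat_rectangle {Y : Set (ℝ × ℝ × ℝ)} (u s : ℝ → ℝ → ℝ)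
    (hu : Continuous fun p : ℝ × ℝ => u p.1 p.2) (hs : Continuous fun p : ℝ × ℝ => s p.1 p.2)
    (a₁ a₂ b₁ b₂ : ℝ)
    (hushift : ∀ x y t t', u (x + t * a₁ + t' * b₁) (y + t * a₂ + t' * b₂) = u x y + t)
    (hsshift : ∀ x y t t', s (x + t * a₁ + t' * b₁) (y + t * a₂ + t' * b₂) = s x y + t')
    {L : ℝ} (hL : 1 ≤ L)
    (habove : ∀ x y z, (x, y, z) ∈ Y → -1 < u x y → u x y < 2 → 0 < s x y → s x y < L + 1 →
      z ≤ -1 ∨ 1 ≤ z)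
    (hbelow : ∀ x y z, (x, y, z) ∈ Y → 0 < u x y → u x y < 1 → -1 < s x y → s x y ≤ 0 →
      z = 0 ∨ z ≤ -1 ∨ 1 ≤ z)
    (hbase : ∀ x y, 0 ≤ u x y → u x y ≤ 1 → -1 ≤ s x y → s x y ≤ 0 → (x, y, 0) ∈ Y) :
    SurfEquiv (Y ∪ {p | 0 ≤ u p.1 p.2.1 ∧ u p.1 p.2.1 ≤ 1 ∧ 0 < s p.1 p.2.1 ∧
      s p.1 p.2.1 ≤ L ∧ p.2.2 = 0}) Y := by
  have hL0 : 0 < L := by linarith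
  have hε0 : 0 < 1 / L := by positivity
  have hε1 : 1 / L ≤ 1 := by rw [div_le_one hL0]; exact hL
  have hsL : ∀ x y, s x y = s x y / L * L := fun x y => by field_simp
  have hLL : 1 / L * L = 1 := by field_simp
  -- the coordinates for the triangle below the diagonal
  set U₂ : ℝ → ℝ → ℝ := fun x y => 2 * u x y - 1 - s x y / L with hU₂
  set S₂ : ℝ → ℝ → ℝ := fun x y => s x y / L with hS₂
  set T₂ : Set (ℝ × ℝ × ℝ) :=
    {p | 0 < S₂ p.1 p.2.1 ∧ S₂ p.1 p.2.1 ≤ 1 - |U₂ p.1 p.2.1| ∧ p.2.2 = 0} with hT₂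
  have hT₂mem : ∀ x y z, (x, y, z) ∈ T₂ ↔ 0 < s x y / L ∧ u x y ≤ 1 ∧ s x y / L ≤ u x y ∧ z = 0 := by
    intro x y z
    simp only [hT₂, mem_ofPred_eq, hS₂, hU₂, le_one_sub_abs_iff]
    constructor
    · rintro ⟨h1, ⟨h2, h3⟩, h4⟩
      exact ⟨h1, by linarith, by linarith, h4⟩
    · rintro ⟨h1, h2, h3, h4⟩
      exact ⟨h1, ⟨by linarith, by linarith⟩, h4⟩
  have step₂ : SurfEquiv (Y ∪ T₂) Y := by
    refine SurfEquiv.collapse_triangle U₂ S₂ (by fun_prop) (by fun_prop)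
      (1 / 2 * a₁ + L * b₁) (1 / 2 * a₂ + L * b₂) (fun x y t => ?_) (fun x y t => ?_) hε0 hε0 ?_ ?_ ?_
    · have h1 := hushift x y (t * (1 / 2)) (t * L)
      have h2 := hsshift x y (t * (1 / 2)) (t * L)
      have ex : x + t * (1 / 2 * a₁ + L * b₁) = x + t * (1 / 2) * a₁ + t * L * b₁ := by ring
      have ey : y + t * (1 / 2 * a₂ + L * b₂) = y + t * (1 / 2) * a₂ + t * L * b₂ := by ring
      simp only [hU₂, ex, ey, h1, h2]
      field_simp; ring
    · have h2 := hsshift x y (t * (1 / 2)) (t * L)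
      have ex : x + t * (1 / 2 * a₁ + L * b₁) = x + t * (1 / 2) * a₁ + t * L * b₁ := by ring
      have ey : y + t * (1 / 2 * a₂ + L * b₂) = y + t * (1 / 2) * a₂ + t * L * b₂ := by ring
      simp only [hS₂, ex, ey, h2]
      field_simp
    · intro x y z hY h1 h2
      simp only [hS₂, hU₂] at h1 h2
      have h3 := neg_abs_le (2 * u x y - 1 - s x y / L)
      have h4 := le_abs_self (2 * u x y - 1 - s x y / L)
      have h5 := abs_nonneg (2 * u x y - 1 - s x y / L)
      have h6 : s x y / L < 1 + 1 / L := by nlinarith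
      refine habove x y z hY ?_ ?_ ?_ ?_
      · nlinarith
      · nlinarith
      · rw [hsL]; positivity
      · rw [hsL]; nlinarith
    · intro x y z hY h0 h1 h2
      simp only [hS₂, hU₂] at h0 h1 h2
      have h3 := neg_abs_le (2 * u x y - 1 - s x y / L)
      have h4 := le_abs_self (2 * u x y - 1 - s x y / L)
      have h5 := abs_nonneg (2 * u x y - 1 - s x y / L)
      have h6 : -(1 / L) < s x y / L := by nlinarith
      have h7 : -(1 - |2 * u x y - 1 - s x y / L|) < s x y / L := by nlinarith
      refine hbelow x y z hY ?_ ?_ ?_ ?_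
      · linarith
      · linarith
      · rw [hsL]; nlinarith
      · rw [hsL]; nlinarith
    · intro x y h0 h1 h2
      simp only [hS₂, hU₂] at h0 h1 h2
      have h3 := neg_abs_le (2 * u x y - 1 - s x y / L)
      have h4 := le_abs_self (2 * u x y - 1 - s x y / L)
      have h5 := abs_nonneg (2 * u x y - 1 - s x y / L)
      have h6 : -(1 / L) ≤ s x y / L := by nlinarith
      have h7 : -(1 - |2 * u x y - 1 - s x y / L|) ≤ s x y / L := by nlinarith
      refine hbase x y ?_ ?_ ?_ ?_
      · linarith
      · linarith
      · rw [hsL]; nlinarith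
      · rw [hsL]; nlinarith
  -- the coordinates for the triangle above the diagonal
  set U₁ : ℝ → ℝ → ℝ := fun x y => u x y + s x y / L - 1 with hU₁
  set S₁ : ℝ → ℝ → ℝ := fun x y => s x y / L - u x y with hS₁
  have step₁ : SurfEquiv ((Y ∪ T₂) ∪
      {p | 0 < S₁ p.1 p.2.1 ∧ S₁ p.1 p.2.1 ≤ 1 - |U₁ p.1 p.2.1| ∧ p.2.2 = 0}) (Y ∪ T₂) := by
    refine SurfEquiv.collapse_triangle U₁ S₁ (by fun_prop) (by fun_prop)
      (-1 / 2 * a₁ + L / 2 * b₁) (-1 / 2 * a₂ + L / 2 * b₂) (fun x y t => ?_) (fun x y t => ?_)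
      (ε := 1) one_pos hε0 ?_ ?_ ?_
    · have h1 := hushift x y (t * (-1 / 2)) (t * (L / 2))
      have h2 := hsshift x y (t * (-1 / 2)) (t * (L / 2))
      have ex : x + t * (-1 / 2 * a₁ + L / 2 * b₁) = x + t * (-1 / 2) * a₁ + t * (L / 2) * b₁ := by ring
      have ey : y + t * (-1 / 2 * a₂ + L / 2 * b₂) = y + t * (-1 / 2) * a₂ + t * (L / 2) * b₂ := by ring
      simp only [hU₁, ex, ey, h1, h2]
      field_simp; ring
    · have h1 := hushift x y (t * (-1 / 2)) (t * (L / 2))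
      have h2 := hsshift x y (t * (-1 / 2)) (t * (L / 2))
      have ex : x + t * (-1 / 2 * a₁ + L / 2 * b₁) = x + t * (-1 / 2) * a₁ + t * (L / 2) * b₁ := by ring
      have ey : y + t * (-1 / 2 * a₂ + L / 2 * b₂) = y + t * (-1 / 2) * a₂ + t * (L / 2) * b₂ := by ring
      simp only [hS₁, ex, ey, h1, h2]
      field_simp; ring
    · intro x y z hY h1 h2
      simp only [hS₁, hU₁] at h1 h2
      rcases hY with hY | hY
      · have h3 := neg_abs_le (u x y + s x y / L - 1)
        have h4 := le_abs_self (u x y + s x y / L - 1)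
        have h5 := abs_nonneg (u x y + s x y / L - 1)
        have h6 : s x y / L - u x y < (1 + 1 / L) * (u x y + s x y / L) := by
          nlinarith
        have h7 : s x y / L - u x y < (1 + 1 / L) * (2 - u x y - s x y / L) := by
          nlinarith
        have h8 : 0 < s x y / L := by
          by_contra h; nlinarith
        have h9 : u x y > -1 := by nlinarith
        have h10 : s x y / L < 1 + 1 / L := by nlinarith
        refine habove x y z hY h9 ?_ ?_ ?_
        · linarith
        · rw [hsL]; positivity
        · rw [hsL]; nlinarith
      · rw [hT₂mem] at hY
        linarith
    · intro x y z hY h0 h1 h2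
      simp only [hS₁, hU₁] at h0 h1 h2
      rcases hY with hY | hY
      · right
        have h3 := neg_abs_le (u x y + s x y / L - 1)
        have h4 := le_abs_self (u x y + s x y / L - 1)
        have h8 : 0 < s x y / L := by linarith
        refine habove x y z hY ?_ ?_ ?_ ?_
        · linarith
        · linarith
        · rw [hsL]; positivity
        · rw [hsL]; nlinarith
      · rw [hT₂mem] at hY
        exact Or.inl hY.2.2.2
    · intro x y h0 h1 h2
      simp only [hS₁, hU₁] at h0 h1 h2
      have h3 := neg_abs_le (u x y + s x y / L - 1)
      have h4 := le_abs_self (u x y + s x y / L - 1)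
      have h8 : 0 ≤ s x y / L := by linarith
      rcases h8.eq_or_lt with h8 | h8
      · left
        have h9 : s x y = 0 := by rw [hsL, ← h8, zero_mul]
        exact hbase x y (by linarith) (by linarith) (by linarith) h9.le
      · right
        rw [hT₂mem]
        exact ⟨h8, by linarith, by linarith, rfl⟩
  refine SurfEquiv.trans ?_ (step₁.trans step₂)
  convert SurfEquiv.refl _ using 1
  rw [union_assoc]
  congr 1
  ext ⟨x, y, z⟩
  have hs1 : 0 < s x y ↔ 0 < s x y / L := by
    rw [lt_div_iff₀ hL0, zero_mul]
  have hs2 : s x y ≤ L ↔ s x y / L ≤ 1 := (div_le_one hL0).symm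
  rw [mem_union, hT₂mem]
  simp only [mem_ofPred_eq, hS₁, hU₁, hs1, hs2, le_one_sub_abs_iff]
  constructor
  · rintro (⟨h1, h2, h3, rfl⟩ | ⟨h1, ⟨h2, h3⟩, rfl⟩)
    · exact ⟨by linarith, by linarith, by linarith, by linarith, rfl⟩
    · exact ⟨by linarith, by linarith, by linarith, by linarith, rfl⟩
  · rintro ⟨h1, h2, h3, h4, rfl⟩
    rcases le_or_gt (s x y / L) (u x y) with h | h
    · exact Or.inl ⟨by linarith, by linarith, by linarith, rfl⟩
    · exact Or.inr ⟨by linarith, ⟨by linarith, by linarith⟩, rfl⟩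

/-- The version of `SurfEquiv.collapse_flat_rectangle` for a rectangle on the graph of a function
`f`. -/
theorem SurfEquiv.collapse_rectangle {Y : Set (ℝ × ℝ × ℝ)} (f : ℝ → ℝ → ℝ)
    (hf : Continuous fun p : ℝ × ℝ => f p.1 p.2) {C : ℝ} (hC : ∀ x y, |f x y| ≤ C)
    (u s : ℝ → ℝ → ℝ)
    (hu : Continuous fun p : ℝ × ℝ => u p.1 p.2) (hs : Continuous fun p : ℝ × ℝ => s p.1 p.2)
    (a₁ a₂ b₁ b₂ : ℝ)
    (hushift : ∀ x y t t', u (x + t * a₁ + t' * b₁) (y + t * a₂ + t' * b₂) = u x y + t)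
    (hsshift : ∀ x y t t', s (x + t * a₁ + t' * b₁) (y + t * a₂ + t' * b₂) = s x y + t')
    {L : ℝ} (hL : 1 ≤ L)
    (habove : ∀ x y z, (x, y, z) ∈ Y → -1 < u x y → u x y < 2 → 0 < s x y → s x y < L + 1 →
      z ≤ f x y - 1 ∨ f x y + 1 ≤ z)
    (hbelow : ∀ x y z, (x, y, z) ∈ Y → 0 < u x y → u x y < 1 → -1 < s x y → s x y ≤ 0 →
      z = f x y ∨ z ≤ f x y - 1 ∨ f x y + 1 ≤ z)
    (hbase : ∀ x y, 0 ≤ u x y → u x y ≤ 1 → -1 ≤ s x y → s x y ≤ 0 → (x, y, f x y) ∈ Y) :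
    SurfEquiv (Y ∪ {p | 0 ≤ u p.1 p.2.1 ∧ u p.1 p.2.1 ≤ 1 ∧ 0 < s p.1 p.2.1 ∧
      s p.1 p.2.1 ≤ L ∧ p.2.2 = f p.1 p.2.1}) Y := by
  refine (SurfEquiv.shear _ f hf hC).trans (SurfEquiv.trans ?_ (SurfEquiv.shear Y f hf hC).symm)
  convert SurfEquiv.collapse_flat_rectangle (Y := {p | (p.1, p.2.1, p.2.2 + f p.1 p.2.1) ∈ Y})
    u s hu hs a₁ a₂ b₁ b₂ hushift hsshift hL ?_ ?_ ?_ using 1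
  · ext ⟨x, y, z⟩
    simp
  · intro x y z hY h1 h2 h3 h4
    rcases habove x y _ hY h1 h2 h3 h4 with h | h
    · left; simp only at h; linarith
    · right; simp only at h; linarith
  · intro x y z hY h1 h2 h3 h4
    rcases hbelow x y _ hY h1 h2 h3 h4 with h | h | h
    · left; simp only at h; linarith
    · right; left; simp only at h; linarith
    · right; right; simp only at h; linarith
  · intro x y h1 h2 h3 h4
    simpa using hbase x y h1 h2 h3 h4

section orientations

variable {X Y : Set (ℝ × ℝ × ℝ)} (f : ℝ → ℝ) (hf : Continuous f) (hf1 : ∀ x, |f x| ≤ 1) (a b : ℝ)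
  {L : ℝ} (hL : 1 ≤ L)
include hf hf1 hL

/-- Collapse of a rectangle of width `1` and length `L`, on the graph of a function of `x`, that is
attached to the rest of the surface along its lower edge. -/
theorem SurfEquiv.collapse_attached_below
    (hX : ∀ x y z, (x, y, z) ∈ X ↔ (x, y, z) ∈ Y ∨
      (a ≤ x ∧ x ≤ a + 1 ∧ b < y ∧ y ≤ b + L ∧ z = f x))
    (hfree : ∀ x y z, (x, y, z) ∈ Y → a - 1 < x → x < a + 2 → b < y → y < b + L + 1 →
      z ≤ f x - 1 ∨ f x + 1 ≤ z)
    (hnear : ∀ x y z, (x, y, z) ∈ Y → a < x → x < a + 1 → b - 1 < y → y ≤ b →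
      z = f x ∨ z ≤ f x - 1 ∨ f x + 1 ≤ z)
    (hbase : ∀ x y, a ≤ x → x ≤ a + 1 → b - 1 ≤ y → y ≤ b → (x, y, f x) ∈ Y) :
    SurfEquiv X Y := by
  convert SurfEquiv.collapse_rectangle (Y := Y) (fun x _ => f x) (by fun_prop) (C := 1)
    (fun x _ => hf1 x) (fun x _ => x - a) (fun _ y => y - b) (by fun_prop) (by fun_prop)
    1 0 0 1 (fun x y t t' => by ring) (fun x y t t' => by ring) hL ?_ ?_ ?_ using 1
  · ext ⟨x, y, z⟩
    rw [hX]
    refine or_congr Iff.rfl ?_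
    constructor <;> rintro ⟨h1, h2, h3, h4, h5⟩ <;>
      exact ⟨by linarith, by linarith, by linarith, by linarith, h5⟩
  · intro x y z h h1 h2 h3 h4
    exact hfree x y z h (by linarith) (by linarith) (by linarith) (by linarith)
  · intro x y z h h1 h2 h3 h4
    exact hnear x y z h (by linarith) (by linarith) (by linarith) (by linarith)
  · intro x y h1 h2 h3 h4
    exact hbase x y (by linarith) (by linarith) (by linarith) (by linarith)

/-- The version of `SurfEquiv.collapse_attached_below` for a rectangle that is attached along its
upper edge. -/
theorem SurfEquiv.collapse_attached_above
    (hX : ∀ x y z, (x, y, z) ∈ X ↔ (x, y, z) ∈ Y ∨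
      (a ≤ x ∧ x ≤ a + 1 ∧ b - L ≤ y ∧ y < b ∧ z = f x))
    (hfree : ∀ x y z, (x, y, z) ∈ Y → a - 1 < x → x < a + 2 → b - L - 1 < y → y < b →
      z ≤ f x - 1 ∨ f x + 1 ≤ z)
    (hnear : ∀ x y z, (x, y, z) ∈ Y → a < x → x < a + 1 → b ≤ y → y < b + 1 →
      z = f x ∨ z ≤ f x - 1 ∨ f x + 1 ≤ z)
    (hbase : ∀ x y, a ≤ x → x ≤ a + 1 → b ≤ y → y ≤ b + 1 → (x, y, f x) ∈ Y) :
    SurfEquiv X Y := by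
  convert SurfEquiv.collapse_rectangle (Y := Y) (fun x _ => f x) (by fun_prop) (C := 1)
    (fun x _ => hf1 x) (fun x _ => x - a) (fun _ y => b - y) (by fun_prop) (by fun_prop)
    1 0 0 (-1) (fun x y t t' => by ring) (fun x y t t' => by ring) hL ?_ ?_ ?_ using 1
  · ext ⟨x, y, z⟩
    rw [hX]
    refine or_congr Iff.rfl ?_
    constructor <;> rintro ⟨h1, h2, h3, h4, h5⟩ <;>
      exact ⟨by linarith, by linarith, by linarith, by linarith, h5⟩
  · intro x y z h h1 h2 h3 h4
    exact hfree x y z h (by linarith) (by linarith) (by linarith) (by linarith)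
  · intro x y z h h1 h2 h3 h4
    exact hnear x y z h (by linarith) (by linarith) (by linarith) (by linarith)
  · intro x y h1 h2 h3 h4
    exact hbase x y (by linarith) (by linarith) (by linarith) (by linarith)

/-- The version of `SurfEquiv.collapse_attached_below` for a rectangle that is attached along its
left edge. -/
theorem SurfEquiv.collapse_attached_left
    (hX : ∀ x y z, (x, y, z) ∈ X ↔ (x, y, z) ∈ Y ∨
      (b < x ∧ x ≤ b + L ∧ a ≤ y ∧ y ≤ a + 1 ∧ z = f x))
    (hfree : ∀ x y z, (x, y, z) ∈ Y → b < x → x < b + L + 1 → a - 1 < y → y < a + 2 →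
      z ≤ f x - 1 ∨ f x + 1 ≤ z)
    (hnear : ∀ x y z, (x, y, z) ∈ Y → b - 1 < x → x ≤ b → a < y → y < a + 1 →
      z = f x ∨ z ≤ f x - 1 ∨ f x + 1 ≤ z)
    (hbase : ∀ x y, b - 1 ≤ x → x ≤ b → a ≤ y → y ≤ a + 1 → (x, y, f x) ∈ Y) :
    SurfEquiv X Y := by
  convert SurfEquiv.collapse_rectangle (Y := Y) (fun x _ => f x) (by fun_prop) (C := 1)
    (fun x _ => hf1 x) (fun _ y => y - a) (fun x _ => x - b) (by fun_prop) (by fun_prop)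
    0 1 1 0 (fun x y t t' => by ring) (fun x y t t' => by ring) hL ?_ ?_ ?_ using 1
  · ext ⟨x, y, z⟩
    rw [hX]
    refine or_congr Iff.rfl ?_
    constructor <;> rintro ⟨h1, h2, h3, h4, h5⟩ <;>
      exact ⟨by linarith, by linarith, by linarith, by linarith, h5⟩
  · intro x y z h h1 h2 h3 h4
    exact hfree x y z h (by linarith) (by linarith) (by linarith) (by linarith)
  · intro x y z h h1 h2 h3 h4
    exact hnear x y z h (by linarith) (by linarith) (by linarith) (by linarith)
  · intro x y h1 h2 h3 h4
    exact hbase x y (by linarith) (by linarith) (by linarith) (by linarith)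

/-- The version of `SurfEquiv.collapse_attached_below` for a rectangle that is attached along its
right edge. -/
theorem SurfEquiv.collapse_attached_right
    (hX : ∀ x y z, (x, y, z) ∈ X ↔ (x, y, z) ∈ Y ∨
      (b - L ≤ x ∧ x < b ∧ a ≤ y ∧ y ≤ a + 1 ∧ z = f x))
    (hfree : ∀ x y z, (x, y, z) ∈ Y → b - L - 1 < x → x < b → a - 1 < y → y < a + 2 →
      z ≤ f x - 1 ∨ f x + 1 ≤ z)
    (hnear : ∀ x y z, (x, y, z) ∈ Y → b ≤ x → x < b + 1 → a < y → y < a + 1 →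
      z = f x ∨ z ≤ f x - 1 ∨ f x + 1 ≤ z)
    (hbase : ∀ x y, b ≤ x → x ≤ b + 1 → a ≤ y → y ≤ a + 1 → (x, y, f x) ∈ Y) :
    SurfEquiv X Y := by
  convert SurfEquiv.collapse_rectangle (Y := Y) (fun x _ => f x) (by fun_prop) (C := 1)
    (fun x _ => hf1 x) (fun _ y => y - a) (fun x _ => b - x) (by fun_prop) (by fun_prop)
    0 1 (-1) 0 (fun x y t t' => by ring) (fun x y t t' => by ring) hL ?_ ?_ ?_ using 1
  · ext ⟨x, y, z⟩
    rw [hX]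
    refine or_congr Iff.rfl ?_
    constructor <;> rintro ⟨h1, h2, h3, h4, h5⟩ <;>
      exact ⟨by linarith, by linarith, by linarith, by linarith, h5⟩
  · intro x y z h h1 h2 h3 h4
    exact hfree x y z h (by linarith) (by linarith) (by linarith) (by linarith)
  · intro x y z h h1 h2 h3 h4
    exact hnear x y z h (by linarith) (by linarith) (by linarith) (by linarith)
  · intro x y h1 h2 h3 h4
    exact hbase x y (by linarith) (by linarith) (by linarith) (by linarith)

end orientations

/-! ### Removing a leaf -/

theorem natCast_le_or_succ_le (a b : ℕ) : (a : ℝ) ≤ b ∨ (b : ℝ) + 1 ≤ a := by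
  rcases le_or_gt a b with h | h
  · exact Or.inl (by exact_mod_cast h)
  · exact Or.inr (by exact_mod_cast h)

theorem natCast_succ_le_or_of_ne {a b : ℕ} (h : a ≠ b) : (a : ℝ) + 1 ≤ b ∨ (b : ℝ) + 1 ≤ a := by
  rcases lt_or_gt_of_ne h with h | h
  · exact Or.inl (by exact_mod_cast h)
  · exact Or.inr (by exact_mod_cast h)

/-- The height of the arm of a letter `a_{i,j}` over the point `x`, continued by `0`. -/
noncomputable def armHeight (i j : ℕ) (x : ℝ) : ℝ :=
  max 0 (min 1 (min (x - (4 * (i : ℝ) + 1)) (4 * (j : ℝ) + 2 - x)))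

theorem continuous_armHeight (i j : ℕ) : Continuous (armHeight i j) := by
  unfold armHeight; fun_prop

theorem abs_armHeight_le_one (i j : ℕ) (x : ℝ) : |armHeight i j x| ≤ 1 := by
  rw [armHeight, abs_of_nonneg (le_max_left _ _)]
  exact max_le zero_le_one (min_le_left _ _)

theorem armHeight_eq_zero {i j : ℕ} {x : ℝ} (h : x ≤ 4 * (i : ℝ) + 1 ∨ 4 * (j : ℝ) + 2 ≤ x) :
    armHeight i j x = 0 := by
  rw [armHeight, max_eq_left]
  rcases h with h | h
  · exact (min_le_right _ _).trans ((min_le_left _ _).trans (by linarith))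
  · exact (min_le_right _ _).trans ((min_le_right _ _).trans (by linarith))

theorem armHeight_eq_one {i j : ℕ} {x : ℝ} (h1 : 4 * (i : ℝ) + 2 ≤ x) (h2 : x ≤ 4 * (j : ℝ) + 1) :
    armHeight i j x = 1 := by
  rw [armHeight, min_eq_left, max_eq_right zero_le_one]
  exact le_min (by linarith) (by linarith)

theorem armHeight_eq_min {i j : ℕ} {x : ℝ} (h1 : 4 * (i : ℝ) + 1 ≤ x) (h2 : x ≤ 4 * (j : ℝ) + 2) :
    armHeight i j x = min 1 (min (x - (4 * (i : ℝ) + 1)) (4 * (j : ℝ) + 2 - x)) := by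
  rw [armHeight, max_eq_right]
  exact le_min zero_le_one (le_min (by linarith) (by linarith))

theorem mem_strandDisc {m k : ℕ} {x y z : ℝ} : (x, y, z) ∈ strandDisc m k ↔
    4 * (k : ℝ) ≤ x ∧ x ≤ 4 * k + 1 ∧ 0 ≤ y ∧ y ≤ 4 * (m : ℝ) + 1 ∧ z = 0 := Iff.rfl

theorem mem_letterBand {l i j : ℕ} {x y z : ℝ} : (x, y, z) ∈ letterBand l i j ↔
    (4 * (i : ℝ) + 1 ≤ x ∧ x ≤ 4 * j + 2 ∧ 4 * (l : ℝ) + 1 ≤ y ∧ y ≤ 4 * l + 2 ∧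
      z = armHeight i j x) ∨
    (4 * (j : ℝ) + 2 ≤ x ∧ x ≤ 4 * j + 3 ∧ 4 * (l : ℝ) + 1 ≤ y ∧ y ≤ 4 * l + 4 ∧ z = 0) ∨
    (4 * (j : ℝ) + 1 ≤ x ∧ x ≤ 4 * j + 2 ∧ 4 * (l : ℝ) + 3 ≤ y ∧ y ≤ 4 * l + 4 ∧ z = 0) := by
  rw [← or_assoc]
  refine or_congr (or_congr ?_ Iff.rfl) Iff.rfl
  refine and_congr_right fun h1 => and_congr_right fun h2 => ?_
  rw [armHeight_eq_min h1 h2]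

/-- The position of the remaining part `Y` of the surface relative to the disc of strand `k` and to
letter number `l`: `Y` passes over the disc at height `1`, and near the level of the letter it
consists of the other discs only. -/
structure IsClearOf (Y : Set (ℝ × ℝ × ℝ)) (l k : ℕ) : Prop where
  near_letter : ∀ x y z, (x, y, z) ∈ Y → 4 * (l : ℝ) < y → y < 4 * l + 5 →
    ∃ k' : ℕ, k' ≠ k ∧ 4 * (k' : ℝ) ≤ x ∧ x ≤ 4 * k' + 1 ∧ z = 0
  near_disc : ∀ x y z, (x, y, z) ∈ Y → 4 * (k : ℝ) - 1 < x → x < 4 * k + 4 → z = 1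

/-- If strand `k` is only met by the letter `a_{i,k}`, its disc and the band of this letter may be
removed. -/
theorem SurfEquiv.collapse_end {Y : Set (ℝ × ℝ × ℝ)} {m l i k : ℕ} (hik : i < k) (hl : l < m)
    (hY : IsClearOf Y l k) (hi : strandDisc m i ⊆ Y) :
    SurfEquiv (Y ∪ (strandDisc m k ∪ letterBand l i k)) Y := by
  have hik' : (i : ℝ) + 1 ≤ k := by exact_mod_cast hik
  have hl' : (l : ℝ) + 1 ≤ m := by exact_mod_cast hl
  have hl0 : (0 : ℝ) ≤ l := l.cast_nonneg
  -- remove the part of the disc above the band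
  set Y₁ : Set (ℝ × ℝ × ℝ) := Y ∪ ({p | 4 * (k : ℝ) ≤ p.1 ∧ p.1 ≤ 4 * k + 1 ∧ 0 ≤ p.2.1 ∧
    p.2.1 ≤ 4 * l + 4 ∧ p.2.2 = 0} ∪ letterBand l i k) with hY₁
  have mem₁ : ∀ x y z, (x, y, z) ∈ Y₁ ↔ (x, y, z) ∈ Y ∨ (4 * (k : ℝ) ≤ x ∧ x ≤ 4 * k + 1 ∧
    0 ≤ y ∧ y ≤ 4 * l + 4 ∧ z = 0) ∨ (x, y, z) ∈ letterBand l i k := fun x y z => Iff.rfl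
  have step₁ : SurfEquiv (Y ∪ (strandDisc m k ∪ letterBand l i k)) Y₁ := by
    refine SurfEquiv.collapse_attached_below (fun _ => 0) continuous_const (by simp)
      (4 * (k : ℝ)) (4 * (l : ℝ) + 4) (L := 4 * (m : ℝ) + 1 - (4 * l + 4)) (by linarith) ?_ ?_ ?_ ?_
    · intro x y z
      rw [mem₁, mem_union, mem_union, mem_strandDisc]
      constructor
      · rintro (h | h | h)
        · exact Or.inl (Or.inl h)
        · rcases le_or_gt y (4 * (l : ℝ) + 4) with h' | h'
          · exact Or.inl (Or.inr (Or.inl ⟨h.1, h.2.1, h.2.2.1, h', h.2.2.2.2⟩))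
          · exact Or.inr ⟨h.1, h.2.1, h', by linarith [h.2.2.2.1], h.2.2.2.2⟩
        · exact Or.inl (Or.inr (Or.inr h))
      · rintro ((h | h | h) | h)
        · exact Or.inl h
        · exact Or.inr (Or.inl ⟨h.1, h.2.1, h.2.2.1, by linarith [h.2.2.2.1], h.2.2.2.2⟩)
        · exact Or.inr (Or.inr h)
        · exact Or.inr (Or.inl ⟨h.1, h.2.1, by linarith [h.2.2.1], by linarith [h.2.2.2.1],
            h.2.2.2.2⟩)
    · intro x y z h h1 h2 h3 h4
      rw [mem₁, mem_letterBand] at h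
      rcases h with h | h | h | h | h
      · exact Or.inr (by linarith [hY.near_disc x y z h (by linarith) (by linarith)])
      all_goals exfalso; linarith [h.2.2.2.1]
    · intro x y z h h1 h2 h3 h4
      rw [mem₁, mem_letterBand] at h
      rcases h with h | h | h | h | h
      · exact Or.inr (Or.inr (by linarith [hY.near_disc x y z h (by linarith) (by linarith)]))
      · exact Or.inl h.2.2.2.2
      · exfalso; linarith [h.2.2.2.1]
      · exact Or.inl h.2.2.2.2
      · exact Or.inl h.2.2.2.2
    · intro x y h1 h2 h3 h4
      rw [mem₁]
      exact Or.inr (Or.inl ⟨h1, h2, by linarith, h4, rfl⟩)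
  -- remove the part of the disc below the end of the band
  set Y₂ : Set (ℝ × ℝ × ℝ) := Y ∪ ({p | 4 * (k : ℝ) ≤ p.1 ∧ p.1 ≤ 4 * k + 1 ∧ 4 * l + 3 ≤ p.2.1 ∧
    p.2.1 ≤ 4 * l + 4 ∧ p.2.2 = 0} ∪ letterBand l i k) with hY₂
  have mem₂ : ∀ x y z, (x, y, z) ∈ Y₂ ↔ (x, y, z) ∈ Y ∨ (4 * (k : ℝ) ≤ x ∧ x ≤ 4 * k + 1 ∧
    4 * (l : ℝ) + 3 ≤ y ∧ y ≤ 4 * l + 4 ∧ z = 0) ∨ (x, y, z) ∈ letterBand l i k :=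
    fun x y z => Iff.rfl
  -- to the right of the disc the arm of the band descends from height `1`; the graph of `f` descends
  -- with it, so that the arm stays at height `1` above the graph
  set f : ℝ → ℝ := fun x => -(min 1 (max 0 (x - 4 * k - 1))) with hf
  have hf0 : ∀ x : ℝ, x ≤ 4 * (k : ℝ) + 1 → f x = 0 := fun x hx => by
    simp only [hf]
    rw [max_eq_left (by linarith), min_eq_right zero_le_one, neg_zero]
  have hfneg : ∀ x, f x ≤ 0 := fun x => by
    have : 0 ≤ min 1 (max 0 (x - 4 * (k : ℝ) - 1)) := le_min zero_le_one (le_max_left _ _)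
    simp only [hf]; linarith
  have hf1 : ∀ x, |f x| ≤ 1 := fun x => by
    rw [abs_of_nonpos (hfneg x)]
    simp only [hf, neg_neg]
    exact min_le_left _ _
  have step₂ : SurfEquiv Y₁ Y₂ := by
    refine SurfEquiv.collapse_attached_above f (by fun_prop) hf1
      (4 * (k : ℝ)) (4 * (l : ℝ) + 3) (L := 4 * (l : ℝ) + 3) (by linarith) ?_ ?_ ?_ ?_
    · intro x y z
      rw [mem₁, mem₂]
      constructor
      · rintro (h | h | h)
        · exact Or.inl (Or.inl h)
        · rcases le_or_gt (4 * (l : ℝ) + 3) y with h' | h'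
          · exact Or.inl (Or.inr (Or.inl ⟨h.1, h.2.1, h', h.2.2.2.1, h.2.2.2.2⟩))
          · exact Or.inr ⟨h.1, h.2.1, by linarith [h.2.2.1], h', by rw [hf0 x h.2.1, h.2.2.2.2]⟩
        · exact Or.inl (Or.inr (Or.inr h))
      · rintro ((h | h | h) | h)
        · exact Or.inl h
        · exact Or.inr (Or.inl ⟨h.1, h.2.1, by linarith [h.2.2.1], h.2.2.2.1, h.2.2.2.2⟩)
        · exact Or.inr (Or.inr h)
        · exact Or.inr (Or.inl ⟨h.1, h.2.1, by linarith [h.2.2.1], by linarith [h.2.2.2.1],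
            by rw [h.2.2.2.2, hf0 x h.2.1]⟩)
    · intro x y z h h1 h2 h3 h4
      rw [mem₂, mem_letterBand] at h
      right
      rcases h with h | h | h | h | h
      · linarith [hY.near_disc x y z h (by linarith) (by linarith), hfneg x]
      · exfalso; linarith [h.2.2.1]
      · obtain ⟨h5, h6, -, -, h7⟩ := h
        rw [h7]
        rcases le_or_gt x (4 * (k : ℝ) + 1) with h8 | h8
        · rw [armHeight_eq_one (by linarith) h8, hf0 x h8]; norm_num
        · rw [armHeight_eq_min h5 h6, min_eq_right (b := (4 * (k : ℝ) + 2 - x)) (by linarith),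
            min_eq_right (by linarith)]
          simp only [hf]
          rw [max_eq_right (by linarith), min_eq_right (by linarith)]
          linarith
      · exfalso; linarith [h.1]
      · exfalso; linarith [h.2.2.1]
    · intro x y z h h1 h2 h3 h4
      rw [mem₂, mem_letterBand] at h
      rw [hf0 x h2.le]
      rcases h with h | h | h | h | h
      · exact Or.inr (Or.inr (by linarith [hY.near_disc x y z h (by linarith) (by linarith)]))
      · exact Or.inl h.2.2.2.2
      · exfalso; linarith [h.2.2.2.1]
      · exact Or.inl h.2.2.2.2
      · exact Or.inl h.2.2.2.2
    · intro x y h1 h2 h3 h4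
      rw [mem₂, hf0 x h2]
      exact Or.inr (Or.inl ⟨h1, h2, h3, by linarith, rfl⟩)
  -- remove the rest of the disc and the end of the band
  set Y₃ : Set (ℝ × ℝ × ℝ) := Y ∪ {p | (4 * (i : ℝ) + 1 ≤ p.1 ∧ p.1 ≤ 4 * k + 2 ∧
    4 * (l : ℝ) + 1 ≤ p.2.1 ∧ p.2.1 ≤ 4 * l + 2 ∧ p.2.2 = armHeight i k p.1) ∨
    (4 * (k : ℝ) + 2 ≤ p.1 ∧ p.1 ≤ 4 * k + 3 ∧ 4 * (l : ℝ) + 1 ≤ p.2.1 ∧ p.2.1 ≤ 4 * l + 4 ∧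
      p.2.2 = 0)} with hY₃
  have mem₃ : ∀ x y z, (x, y, z) ∈ Y₃ ↔ (x, y, z) ∈ Y ∨ (4 * (i : ℝ) + 1 ≤ x ∧ x ≤ 4 * k + 2 ∧
    4 * (l : ℝ) + 1 ≤ y ∧ y ≤ 4 * l + 2 ∧ z = armHeight i k x) ∨
    (4 * (k : ℝ) + 2 ≤ x ∧ x ≤ 4 * k + 3 ∧ 4 * (l : ℝ) + 1 ≤ y ∧ y ≤ 4 * l + 4 ∧
      z = 0) := fun x y z => Iff.rfl
  have step₃ : SurfEquiv Y₂ Y₃ := by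
    refine SurfEquiv.collapse_attached_right (fun _ => 0) continuous_const (by simp)
      (4 * (l : ℝ) + 3) (4 * (k : ℝ) + 2) (L := 2) (by norm_num) ?_ ?_ ?_ ?_
    · intro x y z
      rw [mem₂, mem₃, mem_letterBand]
      constructor
      · rintro (h | h | h | h | h)
        · exact Or.inl (Or.inl h)
        · exact Or.inr ⟨by linarith [h.1], by linarith [h.2.1], h.2.2.1, by linarith [h.2.2.2.1],
            h.2.2.2.2⟩
        · exact Or.inl (Or.inr (Or.inl h))
        · exact Or.inl (Or.inr (Or.inr h))
        · rcases h.2.1.lt_or_eq with h' | h'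
          · exact Or.inr ⟨by linarith [h.1], h', h.2.2.1, by linarith [h.2.2.2.1], h.2.2.2.2⟩
          · exact Or.inl (Or.inr (Or.inr ⟨by linarith, by linarith, by linarith [h.2.2.1],
              h.2.2.2.1, h.2.2.2.2⟩))
      · rintro ((h | h | h) | h)
        · exact Or.inl h
        · exact Or.inr (Or.inr (Or.inl h))
        · exact Or.inr (Or.inr (Or.inr (Or.inl h)))
        · rcases le_or_gt x (4 * (k : ℝ) + 1) with h' | h'
          · exact Or.inr (Or.inl ⟨by linarith [h.1], h', h.2.2.1, by linarith [h.2.2.2.1],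
              h.2.2.2.2⟩)
          · exact Or.inr (Or.inr (Or.inr (Or.inr ⟨h'.le, h.2.1.le, h.2.2.1,
              by linarith [h.2.2.2.1], h.2.2.2.2⟩)))
    · intro x y z h h1 h2 h3 h4
      rw [mem₃] at h
      rcases h with h | h | h
      · exact Or.inr (by linarith [hY.near_disc x y z h (by linarith) (by linarith)])
      · exfalso; linarith [h.2.2.2.1]
      · exfalso; linarith [h.1]
    · intro x y z h h1 h2 h3 h4
      rw [mem₃] at h
      rcases h with h | h | h
      · exact Or.inr (Or.inr (by linarith [hY.near_disc x y z h (by linarith) (by linarith)]))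
      · exfalso; linarith [h.2.2.2.1]
      · exact Or.inl h.2.2.2.2
    · intro x y h1 h2 h3 h4
      rw [mem₃]
      exact Or.inr (Or.inr ⟨h1, by linarith, by linarith, by linarith, rfl⟩)
  -- remove the vertical part of the hook
  set Y₄ : Set (ℝ × ℝ × ℝ) := Y ∪ {p | (4 * (i : ℝ) + 1 ≤ p.1 ∧ p.1 ≤ 4 * k + 3 ∧
    4 * (l : ℝ) + 1 ≤ p.2.1 ∧ p.2.1 ≤ 4 * l + 2 ∧ p.2.2 = armHeight i k p.1)} with hY₄
  have mem₄ : ∀ x y z, (x, y, z) ∈ Y₄ ↔ (x, y, z) ∈ Y ∨ (4 * (i : ℝ) + 1 ≤ x ∧ x ≤ 4 * k + 3 ∧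
    4 * (l : ℝ) + 1 ≤ y ∧ y ≤ 4 * l + 2 ∧ z = armHeight i k x) := fun x y z => Iff.rfl
  have step₄ : SurfEquiv Y₃ Y₄ := by
    refine SurfEquiv.collapse_attached_below (fun _ => 0) continuous_const (by simp)
      (4 * (k : ℝ) + 2) (4 * (l : ℝ) + 2) (L := 2) (by norm_num) ?_ ?_ ?_ ?_
    · intro x y z
      rw [mem₃, mem₄]
      constructor
      · rintro (h | h | h)
        · exact Or.inl (Or.inl h)
        · exact Or.inl (Or.inr ⟨h.1, by linarith [h.2.1], h.2.2⟩)
        · rcases le_or_gt y (4 * (l : ℝ) + 2) with h' | h'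
          · exact Or.inl (Or.inr ⟨by linarith [h.1], h.2.1, h.2.2.1, h',
              by rw [h.2.2.2.2, armHeight_eq_zero (Or.inr h.1)]⟩)
          · exact Or.inr ⟨h.1, by linarith [h.2.1], h', by linarith [h.2.2.2.1], h.2.2.2.2⟩
      · rintro ((h | h) | h)
        · exact Or.inl h
        · rcases le_or_gt x (4 * (k : ℝ) + 2) with h' | h'
          · exact Or.inr (Or.inl ⟨h.1, h', h.2.2⟩)
          · exact Or.inr (Or.inr ⟨h'.le, h.2.1, h.2.2.1, by linarith [h.2.2.2.1],
              by rw [h.2.2.2.2, armHeight_eq_zero (Or.inr h'.le)]⟩)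
        · exact Or.inr (Or.inr ⟨h.1, by linarith [h.2.1], by linarith [h.2.2.1],
            by linarith [h.2.2.2.1], h.2.2.2.2⟩)
    · intro x y z h h1 h2 h3 h4
      rw [mem₄] at h
      rcases h with h | h
      · exact Or.inr (by linarith [hY.near_disc x y z h (by linarith) (by linarith)])
      · exfalso; linarith [h.2.2.2.1]
    · intro x y z h h1 h2 h3 h4
      rw [mem₄] at h
      rcases h with h | h
      · exact Or.inr (Or.inr (by linarith [hY.near_disc x y z h (by linarith) (by linarith)]))
      · exact Or.inl (by rw [h.2.2.2.2, armHeight_eq_zero (Or.inr h1.le)])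
    · intro x y h1 h2 h3 h4
      rw [mem₄]
      exact Or.inr ⟨by linarith, by linarith, by linarith, by linarith,
        by rw [armHeight_eq_zero (Or.inr h1)]⟩
  -- remove the arm of the band, which lies on the graph of `armHeight i k`; the discs that it
  -- crosses lie at distance `1` below this graph
  have step₅ : SurfEquiv Y₄ Y := by
    refine SurfEquiv.collapse_attached_left (armHeight i k) (continuous_armHeight i k)
      (abs_armHeight_le_one i k)
      (4 * (l : ℝ) + 1) (4 * (i : ℝ) + 1) (L := 4 * (k : ℝ) + 3 - (4 * i + 1))
      (by linarith) ?_ ?_ ?_ ?_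
    · intro x y z
      rw [mem₄]
      constructor
      · rintro (h | h)
        · exact Or.inl h
        · rcases h.1.eq_or_lt with h' | h'
          · refine Or.inl (hi ?_)
            rw [mem_strandDisc]
            exact ⟨by linarith, by linarith, by linarith [h.2.2.1], by linarith [h.2.2.2.1],
              by rw [h.2.2.2.2, armHeight_eq_zero (Or.inl h'.symm.le)]⟩
          · exact Or.inr ⟨h', by linarith [h.2.1], h.2.2.1, by linarith [h.2.2.2.1], h.2.2.2.2⟩
      · rintro (h | h)
        · exact Or.inl h
        · exact Or.inr ⟨h.1.le, by linarith [h.2.1], h.2.2.1, by linarith [h.2.2.2.1], h.2.2.2.2⟩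
    · intro x y z h h1 h2 h3 h4
      obtain ⟨k', hk', h5, h6, h7⟩ := hY.near_letter x y z h (by linarith) (by linarith)
      left
      rw [h7, armHeight_eq_one]
      · norm_num
      · rcases natCast_le_or_succ_le k' i with h8 | h8 <;> linarith
      · rcases natCast_succ_le_or_of_ne hk' with h8 | h8 <;> linarith
    · intro x y z h h1 h2 h3 h4
      obtain ⟨k', hk', h5, h6, h7⟩ := hY.near_letter x y z h (by linarith) (by linarith)
      left
      rw [h7, armHeight_eq_zero (Or.inl h2)]
    · intro x y h1 h2 h3 h4
      rw [armHeight_eq_zero (Or.inl h2)]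
      refine hi (mem_strandDisc.2 ⟨by linarith, by linarith, by linarith, by linarith, rfl⟩)
  exact step₁.trans (step₂.trans (step₃.trans (step₄.trans step₅)))

/-- If strand `k` is only met by the letter `a_{k,j}`, its disc and the band of this letter may be
removed. -/
theorem SurfEquiv.collapse_start {Y : Set (ℝ × ℝ × ℝ)} {m l k j : ℕ} (hkj : k < j) (hl : l < m)
    (hY : IsClearOf Y l k) (hj : strandDisc m j ⊆ Y) :
    SurfEquiv (Y ∪ (strandDisc m k ∪ letterBand l k j)) Y := by
  have hkj' : (k : ℝ) + 1 ≤ j := by exact_mod_cast hkj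
  have hl' : (l : ℝ) + 1 ≤ m := by exact_mod_cast hl
  have hl0 : (0 : ℝ) ≤ l := l.cast_nonneg
  -- remove the part of the disc above the band
  set Y₁ : Set (ℝ × ℝ × ℝ) := Y ∪ ({p | 4 * (k : ℝ) ≤ p.1 ∧ p.1 ≤ 4 * k + 1 ∧ 0 ≤ p.2.1 ∧
    p.2.1 ≤ 4 * l + 2 ∧ p.2.2 = 0} ∪ letterBand l k j) with hY₁
  have mem₁ : ∀ x y z, (x, y, z) ∈ Y₁ ↔ (x, y, z) ∈ Y ∨ (4 * (k : ℝ) ≤ x ∧ x ≤ 4 * k + 1 ∧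
    0 ≤ y ∧ y ≤ 4 * l + 2 ∧ z = 0) ∨ (x, y, z) ∈ letterBand l k j := fun x y z => Iff.rfl
  have step₁ : SurfEquiv (Y ∪ (strandDisc m k ∪ letterBand l k j)) Y₁ := by
    refine SurfEquiv.collapse_attached_below (fun _ => 0) continuous_const (by simp)
      (4 * (k : ℝ)) (4 * (l : ℝ) + 2) (L := 4 * (m : ℝ) + 1 - (4 * l + 2)) (by linarith) ?_ ?_ ?_ ?_
    · intro x y z
      rw [mem₁, mem_union, mem_union, mem_strandDisc]
      constructor
      · rintro (h | h | h)
        · exact Or.inl (Or.inl h)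
        · rcases le_or_gt y (4 * (l : ℝ) + 2) with h' | h'
          · exact Or.inl (Or.inr (Or.inl ⟨h.1, h.2.1, h.2.2.1, h', h.2.2.2.2⟩))
          · exact Or.inr ⟨h.1, h.2.1, h', by linarith [h.2.2.2.1], h.2.2.2.2⟩
        · exact Or.inl (Or.inr (Or.inr h))
      · rintro ((h | h | h) | h)
        · exact Or.inl h
        · exact Or.inr (Or.inl ⟨h.1, h.2.1, h.2.2.1, by linarith [h.2.2.2.1], h.2.2.2.2⟩)
        · exact Or.inr (Or.inr h)
        · exact Or.inr (Or.inl ⟨h.1, h.2.1, by linarith [h.2.2.1], by linarith [h.2.2.2.1],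
            h.2.2.2.2⟩)
    · intro x y z h h1 h2 h3 h4
      rw [mem₁, mem_letterBand] at h
      rcases h with h | h | h | h | h
      · exact Or.inr (by linarith [hY.near_disc x y z h (by linarith) (by linarith)])
      all_goals exfalso; linarith [h.2.2.2.1, h.1]
    · intro x y z h h1 h2 h3 h4
      rw [mem₁, mem_letterBand] at h
      rcases h with h | h | h | h | h
      · exact Or.inr (Or.inr (by linarith [hY.near_disc x y z h (by linarith) (by linarith)]))
      · exact Or.inl h.2.2.2.2
      all_goals exfalso; linarith [h.1]
    · intro x y h1 h2 h3 h4
      rw [mem₁]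
      exact Or.inr (Or.inl ⟨h1, h2, by linarith, h4, rfl⟩)
  -- remove the part of the disc below the band
  set Y₂ : Set (ℝ × ℝ × ℝ) := Y ∪ ({p | 4 * (k : ℝ) ≤ p.1 ∧ p.1 ≤ 4 * k + 1 ∧ 4 * l + 1 ≤ p.2.1 ∧
    p.2.1 ≤ 4 * l + 2 ∧ p.2.2 = 0} ∪ letterBand l k j) with hY₂
  have mem₂ : ∀ x y z, (x, y, z) ∈ Y₂ ↔ (x, y, z) ∈ Y ∨ (4 * (k : ℝ) ≤ x ∧ x ≤ 4 * k + 1 ∧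
    4 * (l : ℝ) + 1 ≤ y ∧ y ≤ 4 * l + 2 ∧ z = 0) ∨ (x, y, z) ∈ letterBand l k j :=
    fun x y z => Iff.rfl
  have step₂ : SurfEquiv Y₁ Y₂ := by
    refine SurfEquiv.collapse_attached_above (fun _ => 0) continuous_const (by simp)
      (4 * (k : ℝ)) (4 * (l : ℝ) + 1) (L := 4 * (l : ℝ) + 1) (by linarith) ?_ ?_ ?_ ?_
    · intro x y z
      rw [mem₁, mem₂]
      constructor
      · rintro (h | h | h)
        · exact Or.inl (Or.inl h)
        · rcases le_or_gt (4 * (l : ℝ) + 1) y with h' | h'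
          · exact Or.inl (Or.inr (Or.inl ⟨h.1, h.2.1, h', h.2.2.2.1, h.2.2.2.2⟩))
          · exact Or.inr ⟨h.1, h.2.1, by linarith [h.2.2.1], h', h.2.2.2.2⟩
        · exact Or.inl (Or.inr (Or.inr h))
      · rintro ((h | h | h) | h)
        · exact Or.inl h
        · exact Or.inr (Or.inl ⟨h.1, h.2.1, by linarith [h.2.2.1], h.2.2.2.1, h.2.2.2.2⟩)
        · exact Or.inr (Or.inr h)
        · exact Or.inr (Or.inl ⟨h.1, h.2.1, by linarith [h.2.2.1], by linarith [h.2.2.2.1],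
            h.2.2.2.2⟩)
    · intro x y z h h1 h2 h3 h4
      rw [mem₂, mem_letterBand] at h
      rcases h with h | h | h | h | h
      · exact Or.inr (by linarith [hY.near_disc x y z h (by linarith) (by linarith)])
      all_goals exfalso; linarith [h.2.2.1]
    · intro x y z h h1 h2 h3 h4
      rw [mem₂, mem_letterBand] at h
      rcases h with h | h | h | h | h
      · exact Or.inr (Or.inr (by linarith [hY.near_disc x y z h (by linarith) (by linarith)]))
      · exact Or.inl h.2.2.2.2
      all_goals exfalso; linarith [h.1]
    · intro x y h1 h2 h3 h4
      rw [mem₂]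
      exact Or.inr (Or.inl ⟨h1, h2, h3, by linarith, rfl⟩)
  -- remove the rest of the disc and the arm of the band, which lie on the graph of `armHeight k j`
  set Y₃ : Set (ℝ × ℝ × ℝ) := Y ∪ {p |
    (4 * (j : ℝ) + 2 ≤ p.1 ∧ p.1 ≤ 4 * j + 3 ∧ 4 * (l : ℝ) + 1 ≤ p.2.1 ∧ p.2.1 ≤ 4 * l + 4 ∧
      p.2.2 = 0) ∨
    (4 * (j : ℝ) + 1 ≤ p.1 ∧ p.1 ≤ 4 * j + 2 ∧ 4 * (l : ℝ) + 3 ≤ p.2.1 ∧ p.2.1 ≤ 4 * l + 4 ∧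
      p.2.2 = 0)} with hY₃
  have mem₃ : ∀ x y z, (x, y, z) ∈ Y₃ ↔ (x, y, z) ∈ Y ∨
    (4 * (j : ℝ) + 2 ≤ x ∧ x ≤ 4 * j + 3 ∧ 4 * (l : ℝ) + 1 ≤ y ∧ y ≤ 4 * l + 4 ∧ z = 0) ∨
    (4 * (j : ℝ) + 1 ≤ x ∧ x ≤ 4 * j + 2 ∧ 4 * (l : ℝ) + 3 ≤ y ∧ y ≤ 4 * l + 4 ∧ z = 0) :=
    fun x y z => Iff.rfl
  have step₃ : SurfEquiv Y₂ Y₃ := by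
    refine SurfEquiv.collapse_attached_right (armHeight k j) (continuous_armHeight k j)
      (abs_armHeight_le_one k j)
      (4 * (l : ℝ) + 1) (4 * (j : ℝ) + 2) (L := 4 * (j : ℝ) + 2 - 4 * k) (by linarith) ?_ ?_ ?_ ?_
    · intro x y z
      rw [mem₂, mem₃, mem_letterBand]
      constructor
      · rintro (h | h | h | h | h)
        · exact Or.inl (Or.inl h)
        · exact Or.inr ⟨by linarith [h.1], by linarith [h.2.1], h.2.2.1, by linarith [h.2.2.2.1],
            by rw [h.2.2.2.2, armHeight_eq_zero (Or.inl h.2.1)]⟩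
        · rcases h.2.1.lt_or_eq with h' | h'
          · exact Or.inr ⟨by linarith [h.1], h', h.2.2.1, by linarith [h.2.2.2.1], h.2.2.2.2⟩
          · exact Or.inl (Or.inr (Or.inl ⟨by linarith, by linarith, by linarith [h.2.2.1],
              by linarith [h.2.2.2.1], by rw [h.2.2.2.2, armHeight_eq_zero (Or.inr h'.symm.le)]⟩))
        · exact Or.inl (Or.inr (Or.inl h))
        · exact Or.inl (Or.inr (Or.inr h))
      · rintro ((h | h | h) | h)
        · exact Or.inl h
        · exact Or.inr (Or.inr (Or.inr (Or.inl h)))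
        · exact Or.inr (Or.inr (Or.inr (Or.inr h)))
        · rcases le_or_gt x (4 * (k : ℝ) + 1) with h' | h'
          · exact Or.inr (Or.inl ⟨by linarith [h.1], h', h.2.2.1, by linarith [h.2.2.2.1],
              by rw [h.2.2.2.2, armHeight_eq_zero (Or.inl h')]⟩)
          · exact Or.inr (Or.inr (Or.inl ⟨h'.le, h.2.1.le, h.2.2.1,
              by linarith [h.2.2.2.1], h.2.2.2.2⟩))
    · intro x y z h h1 h2 h3 h4
      rw [mem₃] at h
      rcases h with h | h | h
      · obtain ⟨k', hk', h5, h6, h7⟩ := hY.near_letter x y z h (by linarith) (by linarith)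
        left
        rw [h7, armHeight_eq_one]
        · norm_num
        · rcases natCast_succ_le_or_of_ne hk' with h8 | h8 <;> linarith
        · rcases natCast_le_or_succ_le k' j with h8 | h8 <;> linarith
      · exfalso; linarith [h.1]
      · exfalso; linarith [h.2.2.1]
    · intro x y z h h1 h2 h3 h4
      rw [mem₃] at h
      rw [armHeight_eq_zero (Or.inr h1)]
      rcases h with h | h | h
      · obtain ⟨k', hk', h5, h6, h7⟩ := hY.near_letter x y z h (by linarith) (by linarith)
        exact Or.inl h7
      · exact Or.inl h.2.2.2.2
      · exact Or.inl h.2.2.2.2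
    · intro x y h1 h2 h3 h4
      rw [mem₃, armHeight_eq_zero (Or.inr h1)]
      exact Or.inr (Or.inl ⟨h1, by linarith, by linarith, by linarith, rfl⟩)
  -- remove the vertical part of the hook
  set Y₄ : Set (ℝ × ℝ × ℝ) := Y ∪ {p | (4 * (j : ℝ) + 1 ≤ p.1 ∧ p.1 ≤ 4 * j + 3 ∧
    4 * (l : ℝ) + 3 ≤ p.2.1 ∧ p.2.1 ≤ 4 * l + 4 ∧ p.2.2 = 0)} with hY₄
  have mem₄ : ∀ x y z, (x, y, z) ∈ Y₄ ↔ (x, y, z) ∈ Y ∨ (4 * (j : ℝ) + 1 ≤ x ∧ x ≤ 4 * j + 3 ∧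
    4 * (l : ℝ) + 3 ≤ y ∧ y ≤ 4 * l + 4 ∧ z = 0) := fun x y z => Iff.rfl
  -- there is no disc to the right of strand `j`, at the level of the letter
  have hgap : ∀ x y z, (x, y, z) ∈ Y → 4 * (j : ℝ) + 1 < x → x < 4 * j + 4 → 4 * (l : ℝ) < y →
      y < 4 * l + 5 → False := by
    intro x y z h h1 h2 h3 h4
    obtain ⟨k', -, h5, h6, -⟩ := hY.near_letter x y z h h3 h4
    rcases natCast_le_or_succ_le k' j with h8 | h8 <;> linarith
  have step₄ : SurfEquiv Y₃ Y₄ := by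
    refine SurfEquiv.collapse_attached_above (fun _ => 0) continuous_const (by simp)
      (4 * (j : ℝ) + 2) (4 * (l : ℝ) + 3) (L := 2) (by norm_num) ?_ ?_ ?_ ?_
    · intro x y z
      rw [mem₃, mem₄]
      constructor
      · rintro (h | h | h)
        · exact Or.inl (Or.inl h)
        · rcases le_or_gt (4 * (l : ℝ) + 3) y with h' | h'
          · exact Or.inl (Or.inr ⟨by linarith [h.1], h.2.1, h', h.2.2.2⟩)
          · exact Or.inr ⟨h.1, by linarith [h.2.1], by linarith [h.2.2.1], h', h.2.2.2.2⟩
        · exact Or.inl (Or.inr ⟨h.1, by linarith [h.2.1], h.2.2⟩)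
      · rintro ((h | h) | h)
        · exact Or.inl h
        · rcases le_or_gt x (4 * (j : ℝ) + 2) with h' | h'
          · exact Or.inr (Or.inr ⟨h.1, h', h.2.2⟩)
          · exact Or.inr (Or.inl ⟨h'.le, h.2.1, by linarith [h.2.2.1], h.2.2.2⟩)
        · exact Or.inr (Or.inl ⟨h.1, by linarith [h.2.1], by linarith [h.2.2.1],
            by linarith [h.2.2.2.1], h.2.2.2.2⟩)
    · intro x y z h h1 h2 h3 h4
      rw [mem₄] at h
      rcases h with h | h
      · exact (hgap x y z h (by linarith) (by linarith) (by linarith) (by linarith)).elim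
      · exfalso; linarith [h.2.2.1]
    · intro x y z h h1 h2 h3 h4
      rw [mem₄] at h
      rcases h with h | h
      · exact (hgap x y z h (by linarith) (by linarith) (by linarith) (by linarith)).elim
      · exact Or.inl h.2.2.2.2
    · intro x y h1 h2 h3 h4
      rw [mem₄]
      exact Or.inr ⟨by linarith, by linarith, by linarith, by linarith, rfl⟩
  -- remove the end of the band
  have step₅ : SurfEquiv Y₄ Y := by
    refine SurfEquiv.collapse_attached_left (fun _ => 0) continuous_const (by simp)
      (4 * (l : ℝ) + 3) (4 * (j : ℝ) + 1) (L := 2) (by norm_num) ?_ ?_ ?_ ?_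
    · intro x y z
      rw [mem₄]
      constructor
      · rintro (h | h)
        · exact Or.inl h
        · rcases h.1.eq_or_lt with h' | h'
          · refine Or.inl (hj ?_)
            rw [mem_strandDisc]
            exact ⟨by linarith, by linarith, by linarith [h.2.2.1], by linarith [h.2.2.2.1],
              h.2.2.2.2⟩
          · exact Or.inr ⟨h', by linarith [h.2.1], h.2.2.1, by linarith [h.2.2.2.1], h.2.2.2.2⟩
      · rintro (h | h)
        · exact Or.inl h
        · exact Or.inr ⟨h.1.le, by linarith [h.2.1], h.2.2.1, by linarith [h.2.2.2.1], h.2.2.2.2⟩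
    · intro x y z h h1 h2 h3 h4
      exact (hgap x y z h (by linarith) (by linarith) (by linarith) (by linarith)).elim
    · intro x y z h h1 h2 h3 h4
      obtain ⟨k', hk', h5, h6, h7⟩ := hY.near_letter x y z h (by linarith) (by linarith)
      exact Or.inl h7
    · intro x y h1 h2 h3 h4
      refine hj (mem_strandDisc.2 ⟨by linarith, by linarith, by linarith, by linarith, rfl⟩)
  exact step₁.trans (step₂.trans (step₃.trans (step₄.trans step₅)))

/-! ### Closing the gap left by a removed strand or letter -/

/-- The piecewise linear homeomorphism of the line that maps `[c, c + 5]` to `[c, c + 1]` and is a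
translation on each side of this interval. -/
noncomputable def closeGap (c x : ℝ) : ℝ := x - 4 / 5 * max 0 (min 5 (x - c))

theorem closeGap_of_le {c x : ℝ} (h : x ≤ c) : closeGap c x = x := by
  rw [closeGap, max_eq_left ((min_le_right _ _).trans (by linarith))]; ring

theorem closeGap_of_ge {c x : ℝ} (h : c + 5 ≤ x) : closeGap c x = x - 4 := by
  rw [closeGap, min_eq_left (by linarith), max_eq_right (by norm_num)]; ring

theorem closeGap_of_mem {c x : ℝ} (h : c ≤ x) (h' : x ≤ c + 5) :
    closeGap c x = c + (x - c) / 5 := by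
  rw [closeGap, min_eq_right (by linarith), max_eq_right (by linarith)]; ring

theorem strictMono_closeGap (c : ℝ) : StrictMono (closeGap c) := by
  intro x y h
  have : max 0 (min 5 (y - c)) - max 0 (min 5 (x - c)) ≤ y - x := by
    rcases le_total x c with h1 | h1
    · rw [max_eq_left (b := min 5 (x - c)) ((min_le_right _ _).trans (by linarith)), sub_zero]
      exact max_le (by linarith) ((min_le_right _ _).trans (by linarith))
    · rw [sub_le_iff_le_add]
      rcases le_total 5 (x - c) with h2 | h2
      · rw [min_eq_left h2, min_eq_left (h2.trans (by linarith))]; linarith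
      · rw [min_eq_right h2, max_eq_right (by linarith : (0 : ℝ) ≤ x - c)]
        exact max_le (by linarith) ((min_le_right _ _).trans (by linarith))
  unfold closeGap
  linarith

theorem closeGap_surjective (c : ℝ) : Function.Surjective (closeGap c) := by
  intro y
  rcases le_total y c with h | h
  · exact ⟨y, closeGap_of_le h⟩
  · rcases le_total y (c + 1) with h' | h'
    · exact ⟨c + 5 * (y - c), by rw [closeGap_of_mem (by linarith) (by linarith)]; ring⟩
    · exact ⟨y + 4, by rw [closeGap_of_ge (by linarith)]; ring⟩

theorem abs_closeGap_sub_le (c x : ℝ) : |closeGap c x - x| ≤ 4 := by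
  have h0 : 0 ≤ max 0 (min 5 (x - c)) := le_max_left _ _
  have h1 : max 0 (min 5 (x - c)) ≤ 5 := max_le (by norm_num) (min_le_left _ _)
  rw [closeGap, abs_le]
  constructor <;> linarith

theorem continuous_closeGap (c : ℝ) : Continuous (closeGap c) := by
  unfold closeGap; fun_prop

theorem SurfEquiv.closeGap_fst {X Y : Set (ℝ × ℝ × ℝ)} (c : ℝ)
    (h : ∀ x y z, (x, y, z) ∈ X ↔ (closeGap c x, y, z) ∈ Y) : SurfEquiv X Y := by
  have hc := continuous_closeGap c
  convert SurfEquiv.push (X := X) (1, 0, 0) (fun p => closeGap c p.1 - p.1) (by fun_prop) (C := 4)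
    (fun p => abs_closeGap_sub_le c p.1) (fun p s t hst => ?_) (fun p _ r _ _ => rfl) using 1
  · ext ⟨x, y, z⟩
    constructor
    · intro hY
      obtain ⟨x', rfl⟩ := closeGap_surjective c x
      exact ⟨(x', y, z), (h _ _ _).2 hY, by ext <;> simp⟩
    · rintro ⟨⟨x', y', z'⟩, hX, hq⟩
      have h1 : closeGap c x' = x := by simpa using congrArg (fun p => p.1) hq
      have h2 : y' = y := by simpa using congrArg (fun p => p.2.1) hq
      have h3 : z' = z := by simpa using congrArg (fun p => p.2.2) hq
      subst h1 h2 h3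
      exact (h _ _ _).1 hX
  · have := strictMono_closeGap c (show p.1 + s < p.1 + t by linarith)
    simp only [Prod.fst_add, Prod.smul_fst, smul_eq_mul, mul_one]
    linarith

theorem SurfEquiv.closeGap_snd {X Y : Set (ℝ × ℝ × ℝ)} (c : ℝ)
    (h : ∀ x y z, (x, y, z) ∈ X ↔ (x, closeGap c y, z) ∈ Y) : SurfEquiv X Y := by
  have hc := continuous_closeGap c
  convert SurfEquiv.push (X := X) (0, 1, 0) (fun p => closeGap c p.2.1 - p.2.1) (by fun_prop)
    (C := 4) (fun p => abs_closeGap_sub_le c p.2.1) (fun p s t hst => ?_)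
    (fun p _ r _ _ => rfl) using 1
  · ext ⟨x, y, z⟩
    constructor
    · intro hY
      obtain ⟨y', rfl⟩ := closeGap_surjective c y
      exact ⟨(x, y', z), (h _ _ _).2 hY, by ext <;> simp⟩
    · rintro ⟨⟨x', y', z'⟩, hX, hq⟩
      have h1 : x' = x := by simpa using congrArg (fun p => p.1) hq
      have h2 : closeGap c y' = y := by simpa using congrArg (fun p => p.2.1) hq
      have h3 : z' = z := by simpa using congrArg (fun p => p.2.2) hq
      subst h1 h2 h3
      exact (h _ _ _).1 hX
  · have := strictMono_closeGap c (show p.2.1 + s < p.2.1 + t by linarith)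
    simp only [Prod.fst_add, Prod.snd_add, Prod.smul_fst, Prod.smul_snd, smul_eq_mul, mul_one]
    linarith

/-- The increasing enumeration of the natural numbers other than `k`. -/
def skip (k a : ℕ) : ℕ := if a < k then a else a + 1

theorem skip_ne (k a : ℕ) : skip k a ≠ k := by
  unfold skip; split <;> omega

theorem skip_cases (k a : ℕ) :
    (skip k a = a ∧ (a : ℝ) + 1 ≤ k) ∨ (skip k a = a + 1 ∧ (k : ℝ) ≤ a) := by
  unfold skip
  split
  · exact Or.inl ⟨rfl, by norm_cast⟩
  · exact Or.inr ⟨rfl, by exact_mod_cast (by omega : k ≤ a)⟩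

theorem closeGap_strand (k a : ℕ) {r : ℝ} (h0 : 0 ≤ r) (h3 : r ≤ 3) :
    closeGap (4 * (k : ℝ) - 1) (4 * (skip k a : ℝ) + r) = 4 * a + r := by
  rcases skip_cases k a with ⟨h, h'⟩ | ⟨h, h'⟩ <;> rw [h]
  · rw [closeGap_of_le (by linarith)]
  · push_cast
    rw [closeGap_of_ge (by linarith)]; ring

theorem closeGap_level (l b : ℕ) {r : ℝ} (h1 : 1 ≤ r) (h4 : r ≤ 4) :
    closeGap (4 * (l : ℝ)) (4 * (skip l b : ℝ) + r) = 4 * b + r := by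
  rcases skip_cases l b with ⟨h, h'⟩ | ⟨h, h'⟩ <;> rw [h]
  · rw [closeGap_of_le (by linarith)]
  · push_cast
    rw [closeGap_of_ge (by linarith)]; ring

theorem mem_strandDisc_skip_fst {m k a : ℕ} {x y z : ℝ} :
    (x, y, z) ∈ strandDisc m (skip k a) ↔
      (closeGap (4 * (k : ℝ) - 1) x, y, z) ∈ strandDisc m a := by
  have h0 := closeGap_strand k a le_rfl (by norm_num : (0 : ℝ) ≤ 3)
  have h1 := closeGap_strand k a zero_le_one (by norm_num : (1 : ℝ) ≤ 3)
  rw [mem_strandDisc, mem_strandDisc, ← h1, (strictMono_closeGap _).le_iff_le,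
    show (4 : ℝ) * a = 4 * a + 0 by ring, ← h0, (strictMono_closeGap _).le_iff_le, add_zero]

theorem mem_strandDisc_snd {m l k : ℕ} (hl : l ≤ m) {x y z : ℝ} :
    (x, y, z) ∈ strandDisc (m + 1) k ↔ (x, closeGap (4 * (l : ℝ)) y, z) ∈ strandDisc m k := by
  have hl' : (l : ℝ) ≤ m := by exact_mod_cast hl
  have h0 : closeGap (4 * (l : ℝ)) 0 = 0 := closeGap_of_le (by positivity)
  have h1 : closeGap (4 * (l : ℝ)) (4 * ((m + 1 : ℕ) : ℝ) + 1) = 4 * m + 1 := by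
    push_cast
    rw [closeGap_of_ge (by linarith)]; ring
  rw [mem_strandDisc, mem_strandDisc, ← h1, (strictMono_closeGap _).le_iff_le]
  conv_rhs => rw [← h0]
  rw [(strictMono_closeGap _).le_iff_le]
  simp only [h0]

theorem armHeight_skip {k i j : ℕ} (hij : i < j) (x : ℝ) :
    armHeight (skip k i) (skip k j) x = armHeight i j (closeGap (4 * (k : ℝ) - 1) x) := by
  have hij' : (i : ℝ) + 1 ≤ j := by exact_mod_cast hij
  have hmono := strictMono_closeGap (4 * (k : ℝ) - 1)
  have hc : closeGap (4 * (k : ℝ) - 1) (4 * (k : ℝ) - 1) = 4 * (k : ℝ) - 1 := closeGap_of_le le_rfl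
  have hc' : closeGap (4 * (k : ℝ) - 1) (4 * (k : ℝ) - 1 + 5) = 4 * (k : ℝ) := by
    rw [closeGap_of_ge le_rfl]; ring
  rcases skip_cases k i with ⟨hi, hi'⟩ | ⟨hi, hi'⟩ <;>
    rcases skip_cases k j with ⟨hj, hj'⟩ | ⟨hj, hj'⟩ <;> rw [hi, hj]
  · rcases le_total x (4 * (k : ℝ) - 1) with h | h
    · rw [closeGap_of_le h]
    · have := hmono.monotone h
      rw [armHeight_eq_zero (Or.inr (by linarith)), armHeight_eq_zero (Or.inr (by linarith))]
  · rcases le_total x (4 * (k : ℝ) - 1) with h | h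
    · rw [closeGap_of_le h, armHeight, armHeight]
      push_cast
      rcases le_total (x - (4 * (i : ℝ) + 1)) 1 with h1 | h1
      · rw [min_eq_left (b := 4 * ((j : ℝ) + 1) + 2 - x) (by linarith),
          min_eq_left (b := 4 * (j : ℝ) + 2 - x) (by linarith)]
      · rw [min_eq_left (b := min _ (4 * ((j : ℝ) + 1) + 2 - x)) (le_min h1 (by linarith)),
          min_eq_left (b := min _ (4 * (j : ℝ) + 2 - x)) (le_min h1 (by linarith))]
    · rcases le_total (4 * (k : ℝ) - 1 + 5) x with h' | h'
      · rw [closeGap_of_ge h', armHeight, armHeight]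
        push_cast
        have e : 4 * ((j : ℝ) + 1) + 2 - x = 4 * (j : ℝ) + 2 - (x - 4) := by ring
        rw [e]
        rcases le_total (4 * (j : ℝ) + 2 - (x - 4)) 1 with h1 | h1
        · rw [min_eq_right (a := x - (4 * (i : ℝ) + 1)) (by linarith),
            min_eq_right (a := x - 4 - (4 * (i : ℝ) + 1)) (by linarith)]
        · rw [min_eq_left (le_min (by linarith) h1), min_eq_left (le_min (by linarith) h1)]
      · have h1 := hmono.monotone h
        have h2 := hmono.monotone h'
        rw [armHeight_eq_one (by linarith) (by push_cast; linarith),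
          armHeight_eq_one (by linarith) (by linarith)]
  · linarith
  · rcases le_total (4 * (k : ℝ) - 1 + 5) x with h' | h'
    · rw [closeGap_of_ge h', armHeight, armHeight]
      push_cast
      ring_nf
    · have h2 := hmono.monotone h'
      rw [armHeight_eq_zero (Or.inl (by push_cast; linarith)),
        armHeight_eq_zero (Or.inl (by linarith))]

theorem mem_letterBand_skip_fst {l k i j : ℕ} (hij : i < j) {x y z : ℝ} :
    (x, y, z) ∈ letterBand l (skip k i) (skip k j) ↔
      (closeGap (4 * (k : ℝ) - 1) x, y, z) ∈ letterBand l i j := by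
  have h1 := closeGap_strand k i zero_le_one (by norm_num : (1 : ℝ) ≤ 3)
  have h2 := closeGap_strand k j zero_le_one (by norm_num : (1 : ℝ) ≤ 3)
  have h3 := closeGap_strand k j zero_le_two (by norm_num : (2 : ℝ) ≤ 3)
  have h4 := closeGap_strand k j zero_le_three (le_refl (3 : ℝ))
  rw [mem_letterBand, mem_letterBand, ← armHeight_skip hij, ← h1, ← h2, ← h3, ← h4]
  simp only [(strictMono_closeGap _).le_iff_le]

theorem mem_letterBand_skip_snd {l b i j : ℕ} {x y z : ℝ} :
    (x, y, z) ∈ letterBand (skip l b) i j ↔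
      (x, closeGap (4 * (l : ℝ)) y, z) ∈ letterBand b i j := by
  have h1 := closeGap_level l b le_rfl (by norm_num : (1 : ℝ) ≤ 4)
  have h2 := closeGap_level l b one_le_two (by norm_num : (2 : ℝ) ≤ 4)
  have h3 := closeGap_level l b (by norm_num : (1 : ℝ) ≤ 3) (by norm_num)
  have h4 := closeGap_level l b (by norm_num : (1 : ℝ) ≤ 4) le_rfl
  rw [mem_letterBand, mem_letterBand, ← h1, ← h2, ← h3, ← h4]
  simp only [(strictMono_closeGap _).le_iff_le]

/-! ### Removing a strand of degree one -/

theorem mem_canonicalSet {n : ℕ} {w : SQPWord n} {p : ℝ × ℝ × ℝ} :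
    p ∈ canonicalSet w ↔ (∃ k : Fin n, p ∈ strandDisc w.length k) ∨
      ∃ (l : ℕ) (h : l < w.length), p ∈ letterBand l w[l].startStrand w[l].endStrand := by
  simp [canonicalSet, Fin.exists_iff]

theorem List.exists_of_countP_eq_one {α : Type*} {P : α → Bool} {w : List α}
    (h : w.countP P = 1) : ∃ (i : ℕ) (hi : i < w.length), P w[i] = true ∧
      ∀ (j : ℕ) (hj : j < w.length), j ≠ i → P w[j] = false := by
  induction w with
  | nil => simp at h
  | cons a w ih =>
    by_cases ha : P a = true
    · rw [List.countP_cons_of_pos ha, Nat.add_eq_right, List.countP_eq_zero] at h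
      refine ⟨0, by simp, by simpa, fun j hj hj0 => ?_⟩
      obtain ⟨j, rfl⟩ := Nat.exists_eq_succ_of_ne_zero hj0
      simpa using h _ (List.getElem_mem (by simpa using hj : j < w.length))
    · rw [List.countP_cons_of_neg ha] at h
      obtain ⟨i, hi, h1, h2⟩ := ih h
      refine ⟨i + 1, by simpa using hi, by simpa using h1, fun j hj hji => ?_⟩
      cases j with
      | zero => simpa using ha
      | succ j => simpa using h2 j (by simpa using hj) (by omega)

theorem z_eq_one_of_mem_letterBand {l i j k : ℕ} (hij : i < j) (hi : i ≠ k) (hj : j ≠ k)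
    {x y z : ℝ} (h : (x, y, z) ∈ letterBand l i j) (h1 : 4 * (k : ℝ) - 1 < x)
    (h2 : x < 4 * k + 4) : z = 1 := by
  have hij' : (i : ℝ) + 1 ≤ j := by exact_mod_cast hij
  rw [mem_letterBand] at h
  rcases natCast_succ_le_or_of_ne hi with h3 | h3
  · rcases natCast_succ_le_or_of_ne hj with h4 | h4
    · rcases h with h | h | h <;> linarith [h.2.1]
    · rcases h with h | h | h
      · rw [h.2.2.2.2, armHeight_eq_one (by linarith) (by linarith)]
      · linarith [h.1]
      · linarith [h.1]
  · rcases h with h | h | h <;> linarith [h.1]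

/-- A strand that is met by exactly one letter may be removed from a strongly quasipositive word
together with this letter. -/
theorem exists_surfEquiv_of_degree_eq_one {n : ℕ} (w : SQPWord (n + 1)) (k : Fin (n + 1))
    (hk : w.degree k = 1) :
    ∃ v : SQPWord n, SurfEquiv (canonicalSet v) (canonicalSet w) := by
  obtain ⟨l, hl, hlk, hother⟩ := List.exists_of_countP_eq_one hk
  simp only [decide_eq_true_eq, decide_eq_false_iff_not, not_or] at hlk hother
  obtain ⟨m, hm⟩ : ∃ m, w.length = m + 1 := ⟨w.length - 1, by omega⟩
  have hskip : ∀ b : Fin m, skip l b < w.length := fun b => by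
    unfold skip; split <;> omega
  have hval : ∀ a : Fin n, (k.succAbove a : ℕ) = skip k a := fun a => by
    simp only [Fin.succAbove, skip, Fin.lt_def, Fin.val_castSucc]
    split <;> rfl
  -- the other letters, as letters on the other strands
  have hg : ∀ b : Fin m, ∃ g : BandGen n, skip k g.startStrand = (w[skip l b]'(hskip b)).startStrand ∧
      skip k g.endStrand = (w[skip l b]'(hskip b)).endStrand := by
    intro b
    obtain ⟨h1, h2⟩ := hother _ (hskip b) (skip_ne l b)
    obtain ⟨i, hi⟩ := Fin.exists_succAbove_eq h1
    obtain ⟨j, hj⟩ := Fin.exists_succAbove_eq h2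
    refine ⟨⟨i, j, ?_⟩, ?_, ?_⟩
    · have := (w[skip l b]'(hskip b)).lt
      rwa [← hi, ← hj, (Fin.strictMono_succAbove k).lt_iff_lt] at this
    · exact (hval i).symm.trans (congrArg Fin.val hi)
    · exact (hval j).symm.trans (congrArg Fin.val hj)
  choose g hgs hge using hg
  set Y : Set (ℝ × ℝ × ℝ) := {p | (∃ a : Fin n, p ∈ strandDisc w.length (skip k a)) ∨
    ∃ b : Fin m, p ∈ letterBand (skip l b) (skip k (g b).startStrand) (skip k (g b).endStrand)}
    with hY
  refine ⟨List.ofFn g, SurfEquiv.trans (Y := Y) (SurfEquiv.symm ?_) (SurfEquiv.symm ?_)⟩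
  · refine SurfEquiv.trans (Y := {p | (∃ a : Fin n, p ∈ strandDisc w.length a) ∨
      ∃ b : Fin m, p ∈ letterBand (skip l b) (g b).startStrand (g b).endStrand}) ?_ ?_
    · refine SurfEquiv.closeGap_fst (4 * ((k : ℕ) : ℝ) - 1) fun x y z => ?_
      refine or_congr (exists_congr fun a => mem_strandDisc_skip_fst) (exists_congr fun b => ?_)
      exact mem_letterBand_skip_fst (g b).lt
    · refine SurfEquiv.closeGap_snd (4 * (l : ℝ)) fun x y z => ?_
      rw [mem_canonicalSet]
      simp only [List.length_ofFn, List.getElem_ofFn]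
      refine or_congr (exists_congr fun a => by rw [hm]; exact mem_strandDisc_snd (by omega)) ?_
      rw [Fin.exists_iff]
      exact exists_congr fun b => exists_congr fun hb => mem_letterBand_skip_snd
  · have hsplit : canonicalSet w = Y ∪ (strandDisc w.length k ∪
        letterBand l w[l].startStrand w[l].endStrand) := by
      ext p
      rw [mem_canonicalSet, Fin.exists_iff_succAbove k]
      simp only [hval]
      have : (∃ (l' : ℕ) (h : l' < w.length), p ∈ letterBand l' w[l'].startStrand w[l'].endStrand) ↔
          p ∈ letterBand l w[l].startStrand w[l].endStrand ∨ ∃ b : Fin m,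
            p ∈ letterBand (skip l b) (skip k (g b).startStrand) (skip k (g b).endStrand) := by
        simp only [hgs, hge]
        constructor
        · rintro ⟨l', hl', h⟩
          rcases lt_trichotomy l' l with h' | rfl | h'
          · right
            refine ⟨⟨l', by omega⟩, ?_⟩
            have : skip l l' = l' := if_pos h'
            simpa only [this] using h
          · exact Or.inl h
          · right
            refine ⟨⟨l' - 1, by omega⟩, ?_⟩
            have : skip l (l' - 1) = l' := by unfold skip; split <;> omega
            simpa only [this] using h
        · rintro (h | ⟨b, h⟩)
          · exact ⟨l, hl, h⟩
          · exact ⟨_, hskip b, h⟩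
      rw [this]
      simp only [hY, mem_union, mem_ofPred_eq]
      tauto
    have hclear : IsClearOf Y l k := by
      constructor
      · rintro x y z (⟨a, h⟩ | ⟨b, h⟩) h1 h2
        · rw [mem_strandDisc] at h
          exact ⟨_, skip_ne _ _, h.1, h.2.1, h.2.2.2.2⟩
        · exfalso
          rw [mem_letterBand] at h
          rcases natCast_succ_le_or_of_ne (skip_ne l b) with h' | h' <;>
            rcases h with h | h | h <;> linarith [h.2.2.1, h.2.2.2.1]
      · rintro x y z (⟨a, h⟩ | ⟨b, h⟩) h1 h2
        · exfalso
          rw [mem_strandDisc] at h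
          rcases natCast_succ_le_or_of_ne (skip_ne k a) with h' | h' <;>
            linarith [h.1, h.2.1]
        · refine z_eq_one_of_mem_letterBand ?_ (skip_ne _ _) (skip_ne _ _) h h1 h2
          rw [hgs, hge]
          exact (w[skip l b]'(hskip b)).lt
    have hdisc : ∀ i : Fin (n + 1), i ≠ k → strandDisc w.length i ⊆ Y := by
      intro i hi p hp
      obtain ⟨a, rfl⟩ := Fin.exists_succAbove_eq hi
      exact Or.inl ⟨a, by rwa [hval] at hp⟩
    rw [hsplit]
    rcases hlk with h | h
    · have hlt := w[l].lt
      rw [h] at hlt ⊢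
      exact SurfEquiv.collapse_start hlt hl hclear (hdisc _ hlt.ne')
    · have hlt := w[l].lt
      rw [h] at hlt ⊢
      exact SurfEquiv.collapse_end hlt hl hclear (hdisc _ hlt.ne)

/-! ### Lifting maps to the circle -/

section circle_lifts

variable {X : Type*} [TopologicalSpace X]

/-- A map to the circle lifts to the line. -/
def LiftsToLine (f : X → UnitAddCircle) : Prop :=
  ∃ h : X → ℝ, Continuous h ∧ ∀ x, ((h x : ℝ) : UnitAddCircle) = f x

theorem LiftsToLine.of_homotopy {f : C(unitInterval × X, UnitAddCircle)}
    (h0 : LiftsToLine fun x => f (0, x)) (t : unitInterval) : LiftsToLine fun x => f (t, x) := by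
  obtain ⟨h, hc, hh⟩ := h0
  have cov := AddCircle.isCoveringMap_coe (1 : ℝ)
  have H0 : ∀ x, f (0, x) = ((⟨h, hc⟩ : C(X, ℝ)) x : UnitAddCircle) := fun x => (hh x).symm
  refine ⟨fun x => cov.liftHomotopy f ⟨h, hc⟩ H0 (t, x), by fun_prop, fun x => ?_⟩
  exact congrFun (cov.liftHomotopy_lifts f ⟨h, hc⟩ H0) (t, x)

theorem liftsToLine_of_contractible [ContractibleSpace X] {f : X → UnitAddCircle}
    (hf : Continuous f) : LiftsToLine f := by
  obtain ⟨x₀, ⟨H⟩⟩ := id_nullhomotopic X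
  obtain ⟨r, hr⟩ := QuotientAddGroup.mk_surjective (f x₀)
  have := LiftsToLine.of_homotopy (f := ⟨fun p => f (H.symm p), by fun_prop⟩)
    ⟨fun _ => r, continuous_const, fun x => by simpa using hr⟩ 1
  simpa using this

theorem exists_int_of_coe_eq_zero {r : ℝ} (h : (r : UnitAddCircle) = 0) : ∃ n : ℤ, (n : ℝ) = r := by
  obtain ⟨n, hn⟩ := (AddCircle.coe_eq_zero_iff (1 : ℝ)).1 h
  exact ⟨n, by simpa using hn⟩

/-- A continuous function with integer values is constant on every connected set. -/
theorem IsPreconnected.eq_of_coe_eq_zero {S : Set X} (hS : IsPreconnected S) {h : X → ℝ}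
    (hc : ContinuousOn h S) (hh : ∀ x ∈ S, (h x : UnitAddCircle) = 0) {x y : X} (hx : x ∈ S)
    (hy : y ∈ S) : h x = h y := by
  by_contra hne
  wlog hlt : h x < h y generalizing x y
  · exact this hy hx (Ne.symm hne) (lt_of_le_of_ne (not_lt.1 hlt) (Ne.symm hne))
  obtain ⟨a, ha⟩ := exists_int_of_coe_eq_zero (hh x hx)
  obtain ⟨b, hb⟩ := exists_int_of_coe_eq_zero (hh y hy)
  have hab : (a : ℝ) + 1 ≤ b := by
    rw [← ha, ← hb] at hlt
    exact_mod_cast hlt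
  obtain ⟨z, hz, hz'⟩ := (hS.image h hc).ordConnected.out (mem_image_of_mem h hx)
    (mem_image_of_mem h hy) (show (a : ℝ) + 1 / 2 ∈ Icc (h x) (h y) from
      ⟨by linarith, by linarith⟩)
  obtain ⟨c, hc⟩ := exists_int_of_coe_eq_zero (hh z hz)
  rw [← hc] at hz'
  have h1 : a < c := by
    have : (a : ℝ) < c := by linarith
    exact_mod_cast this
  have h2 : c < a + 1 := by
    have : (c : ℝ) < a + 1 := by linarith
    exact_mod_cast this
  omega

end circle_lifts

/-- The identity of the circle does not lift to the line. -/
theorem not_liftsToLine_id : ¬ LiftsToLine (id : UnitAddCircle → UnitAddCircle) := by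
  rintro ⟨h, hc, hh⟩
  have h1 := (isPreconnected_univ (α := ℝ)).eq_of_coe_eq_zero
    (h := fun t : ℝ => h (t : UnitAddCircle) - t)
    (Continuous.continuousOn (by
      have : Continuous fun t : ℝ => (t : UnitAddCircle) := AddCircle.continuous_mk' 1
      fun_prop)) (fun t _ => by simp [hh]) (mem_univ 0) (mem_univ 1)
  have h2 : ((1 : ℝ) : UnitAddCircle) = ((0 : ℝ) : UnitAddCircle) := by
    simp
  simp only [h2] at h1
  linarith

/-- Of the two windings of a pair of maps from the annulus to the circle a suitable combination
vanishes, so that the same combination of the maps lifts. -/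
theorem exists_zsmul_add_zsmul_liftsToLine {f g : UnitAddCircle × unitInterval → UnitAddCircle}
    (hf : Continuous f) (hg : Continuous g) : ∃ p q : ℤ, (p ≠ 0 ∨ q ≠ 0) ∧
      LiftsToLine fun x => p • f x + q • g x := by
  have cov := AddCircle.isCoveringMap_coe (1 : ℝ)
  have hmk : Continuous fun t : ℝ => (t : UnitAddCircle) := AddCircle.continuous_mk' 1
  -- lift the restriction of a map to the core circle, as a loop
  have hlift : ∀ f : UnitAddCircle × unitInterval → UnitAddCircle, Continuous f →
      ∃ (Γ : C(unitInterval, ℝ)) (d : ℤ), (∀ t, (Γ t : UnitAddCircle) = f (((t : ℝ) : UnitAddCircle), 0)) ∧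
        Γ 1 = Γ 0 + d := by
    intro f hf
    obtain ⟨r, hr⟩ := QuotientAddGroup.mk_surjective (f (((0 : ℝ) : UnitAddCircle), 0))
    obtain ⟨Γ, h1, h2⟩ := cov.exists_path_lifts
      ⟨fun t : unitInterval => f (((t : ℝ) : UnitAddCircle), 0), by fun_prop⟩ r hr.symm
    have h3 : ∀ t, (Γ t : UnitAddCircle) = f (((t : ℝ) : UnitAddCircle), 0) := fun t => congrFun h1 t
    have h4 : ((1 : ℝ) : UnitAddCircle) = ((0 : ℝ) : UnitAddCircle) := by
      simp
    obtain ⟨d, hd⟩ := exists_int_of_coe_eq_zero (r := Γ 1 - Γ 0) (by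
      rw [AddCircle.coe_sub, h3, h3]
      simp only [Icc.coe_one, Icc.coe_zero, h4, sub_self])
    exact ⟨Γ, d, h3, by rw [hd]; ring⟩
  obtain ⟨Γ, a, hΓ, ha⟩ := hlift f hf
  obtain ⟨Δ, b, hΔ, hb⟩ := hlift g hg
  obtain ⟨p, q, hpq, h0⟩ : ∃ p q : ℤ, (p ≠ 0 ∨ q ≠ 0) ∧ p * a + q * b = 0 := by
    by_cases hab : a = 0
    · exact ⟨1, 0, Or.inl one_ne_zero, by simp [hab]⟩
    · exact ⟨b, -a, Or.inr (neg_ne_zero.2 hab), by ring⟩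
  refine ⟨p, q, hpq, ?_⟩
  have h0' : (p : ℝ) * a + q * b = 0 := by exact_mod_cast h0
  have hcore : LiftsToLine fun x : UnitAddCircle => p • f (x, 0) + q • g (x, 0) := by
    set E : ℝ → ℝ := fun t => p * Γ (projIcc 0 1 zero_le_one t) + q * Δ (projIcc 0 1 zero_le_one t)
      with hE
    have hEc : Continuous E := by fun_prop
    refine ⟨AddCircle.liftIco 1 0 E, AddCircle.liftIco_zero_continuous ?_ hEc.continuousOn,
      fun x => ?_⟩
    · simp only [hE, projIcc_left, projIcc_right]
      change p * Γ 0 + q * Δ 0 = p * Γ 1 + q * Δ 1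
      rw [ha, hb]
      linear_combination -h0'
    · obtain ⟨t, ht, rfl⟩ : ∃ t ∈ Ico (0 : ℝ) 1, (t : UnitAddCircle) = x := by
        have := AddCircle.coe_image_Ico_eq (1 : ℝ) 0
        have hx : x ∈ QuotientAddGroup.mk '' Ico (0 : ℝ) (0 + 1) := by rw [this]; trivial
        obtain ⟨t, ht, h⟩ := hx
        exact ⟨t, by simpa using ht, h⟩
      rw [AddCircle.liftIco_zero_coe_apply ht]
      simp only [hE]
      have e : projIcc 0 1 zero_le_one t = (⟨t, ht.1, ht.2.le⟩ : unitInterval) :=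
        projIcc_of_mem _ ⟨ht.1, ht.2.le⟩
      rw [e, AddCircle.coe_add, ← zsmul_eq_mul, ← zsmul_eq_mul, AddCircle.coe_zsmul,
        AddCircle.coe_zsmul, hΓ, hΔ]
  -- the annulus is a homotopy of its core circles
  have hc1 : Continuous fun y : unitInterval × (UnitAddCircle × unitInterval) =>
      f (y.2.1, y.1 * y.2.2) := by fun_prop
  have hc2 : Continuous fun y : unitInterval × (UnitAddCircle × unitInterval) =>
      g (y.2.1, y.1 * y.2.2) := by fun_prop
  have := LiftsToLine.of_homotopy (X := UnitAddCircle × unitInterval)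
    (f := ⟨fun y => p • f (y.2.1, y.1 * y.2.2) + q • g (y.2.1, y.1 * y.2.2), by fun_prop⟩) ?_ 1
  · simpa using this
  · obtain ⟨h, hc, hh⟩ := hcore
    exact ⟨fun x => h x.1, by fun_prop, fun x => by simp [hh]⟩

/-! ### The number of bands of an annulus -/

/-- A homomorphism `ℤⁿ → ℤᵐ` that kills a non-zero vector and whose cokernel has rank at most one
exists only if `m ≤ n`. -/
theorem le_of_cokernel_rank_le_one {m n : ℕ} (δ : (Fin n → ℤ) →ₗ[ℤ] (Fin m → ℤ)) {v : Fin n → ℤ}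
    (hv : v ≠ 0) (hδv : δ v = 0)
    (h : ∀ c c' : Fin m → ℤ, ∃ p q : ℤ, (p ≠ 0 ∨ q ≠ 0) ∧ p • c + q • c' ∈ LinearMap.range δ) :
    m ≤ n := by
  have h1 := Submodule.finrank_quotient_add_finrank (LinearMap.range δ)
  have h2 := Submodule.finrank_quotient_add_finrank (LinearMap.ker δ)
  rw [(LinearMap.quotKerEquivRange δ).finrank_eq] at h2
  simp only [Module.finrank_fin_fun] at h1 h2
  have h3 : 1 ≤ Module.finrank ℤ (LinearMap.ker δ) := by
    rw [Submodule.one_le_finrank_iff, Submodule.ne_bot_iff]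
    exact ⟨v, hδv, hv⟩
  have h4 : Module.finrank ℤ ((Fin m → ℤ) ⧸ LinearMap.range δ) < 2 := by
    by_contra hge
    obtain ⟨e, he⟩ := exists_linearIndependent_of_le_finrank (not_lt.1 hge)
    obtain ⟨c, hc⟩ := Submodule.Quotient.mk_surjective _ (e 0)
    obtain ⟨c', hc'⟩ := Submodule.Quotient.mk_surjective _ (e 1)
    have he' : LinearIndependent ℤ ![e 0, e 1] := by
      convert he using 1
      ext i; fin_cases i <;> rfl
    obtain ⟨p, q, hpq, hr⟩ := h c c'
    rw [LinearIndependent.pair_iff] at he'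
    have := he' p q (by
      rw [← hc, ← hc', ← Submodule.Quotient.mk_smul, ← Submodule.Quotient.mk_smul,
        ← Submodule.Quotient.mk_add]
      exact (Submodule.Quotient.mk_eq_zero _).2 hr)
    rcases hpq with h | h
    · exact h this.1
    · exact h this.2
  omega

theorem isClosed_graph_over_rectangle (a b c d : ℝ) {f : ℝ → ℝ} (hf : Continuous f) :
    IsClosed {p : ℝ × ℝ × ℝ | a ≤ p.1 ∧ p.1 ≤ b ∧ c ≤ p.2.1 ∧ p.2.1 ≤ d ∧ p.2.2 = f p.1} := by
  have h : IsClosed {p : ℝ × ℝ × ℝ | p.2.2 = f p.1} := isClosed_eq (by fun_prop) (by fun_prop)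
  convert (isClosed_Icc.prod (isClosed_Icc.prod isClosed_univ) :
    IsClosed (Icc a b ×ˢ Icc c d ×ˢ (univ : Set ℝ))).inter h using 1
  ext ⟨x, y, z⟩
  simp [and_assoc]

theorem isClosed_strandDisc (m k : ℕ) : IsClosed (strandDisc m k) :=
  isClosed_graph_over_rectangle _ _ _ _ continuous_const

theorem isClosed_letterBand (l i j : ℕ) : IsClosed (letterBand l i j) := by
  refine IsClosed.union (IsClosed.union ?_ ?_) ?_
  · exact isClosed_graph_over_rectangle _ _ _ _
      (f := fun x => min 1 (min (x - (4 * (i : ℝ) + 1)) (4 * (j : ℝ) + 2 - x))) (by fun_prop)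
  · exact isClosed_graph_over_rectangle _ _ _ _ continuous_const
  · exact isClosed_graph_over_rectangle _ _ _ _ continuous_const

theorem strandDisc_eq_prod (m k : ℕ) : strandDisc m k =
    Icc (4 * (k : ℝ)) (4 * k + 1) ×ˢ Icc (0 : ℝ) (4 * (m : ℝ) + 1) ×ˢ {(0 : ℝ)} := by
  ext ⟨x, y, z⟩
  rw [mem_strandDisc]
  simp [and_assoc]

theorem convex_strandDisc (m k : ℕ) : Convex ℝ (strandDisc m k) := by
  rw [strandDisc_eq_prod]
  exact (convex_Icc _ _).prod ((convex_Icc _ _).prod (convex_singleton _))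

theorem isPreconnected_strandDisc (m k : ℕ) : IsPreconnected (strandDisc m k) :=
  (convex_strandDisc m k).isPreconnected

theorem isPreconnected_letterBand {l i j : ℕ} (hij : i < j) :
    IsPreconnected (letterBand l i j) := by
  have hij' : (i : ℝ) + 1 ≤ j := by exact_mod_cast hij
  have h1 : IsPreconnected ((fun q : ℝ × ℝ => (q.1, q.2, armHeight i j q.1)) ''
      (Icc (4 * (i : ℝ) + 1) (4 * j + 2) ×ˢ Icc (4 * (l : ℝ) + 1) (4 * l + 2))) :=
    ((convex_Icc _ _).prod (convex_Icc _ _)).isPreconnected.image _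
      (by have := continuous_armHeight i j; fun_prop)
  have h2 : IsPreconnected (Icc (4 * (j : ℝ) + 2) (4 * j + 3) ×ˢ
      Icc (4 * (l : ℝ) + 1) (4 * l + 4) ×ˢ {(0 : ℝ)}) :=
    ((convex_Icc _ _).prod ((convex_Icc _ _).prod (convex_singleton _))).isPreconnected
  have h3 : IsPreconnected (Icc (4 * (j : ℝ) + 1) (4 * j + 2) ×ˢ
      Icc (4 * (l : ℝ) + 3) (4 * l + 4) ×ˢ {(0 : ℝ)}) :=
    ((convex_Icc _ _).prod ((convex_Icc _ _).prod (convex_singleton _))).isPreconnected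
  have h12 := by
    refine IsPreconnected.union (4 * (j : ℝ) + 2, 4 * (l : ℝ) + 1, (0 : ℝ)) ?_ ?_ h1 h2
    · exact ⟨(4 * (j : ℝ) + 2, 4 * (l : ℝ) + 1),
        ⟨⟨by linarith, le_rfl⟩, le_rfl, by linarith⟩, by simp [armHeight_eq_zero]⟩
    · exact ⟨⟨le_rfl, by linarith⟩, ⟨le_rfl, by linarith⟩, rfl⟩
  have h123 := by
    refine IsPreconnected.union (4 * (j : ℝ) + 2, 4 * (l : ℝ) + 4, (0 : ℝ)) ?_ ?_ h12 h3
    · exact Or.inr ⟨⟨le_rfl, by linarith⟩, ⟨by linarith, le_rfl⟩, rfl⟩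
    · exact ⟨⟨by linarith, le_rfl⟩, ⟨by linarith, le_rfl⟩, rfl⟩
  convert h123 using 1
  ext ⟨x, y, z⟩
  rw [mem_letterBand, mem_union, mem_union, or_assoc]
  refine or_congr ?_ (or_congr ?_ ?_)
  · constructor
    · rintro ⟨h1, h2, h3, h4, rfl⟩
      exact ⟨(x, y), ⟨⟨h1, h2⟩, h3, h4⟩, rfl⟩
    · rintro ⟨⟨x', y'⟩, ⟨⟨h1, h2⟩, h3, h4⟩, h5⟩
      simp only [Prod.mk.injEq] at h5 h1 h2 h3 h4
      obtain ⟨rfl, rfl, rfl⟩ := h5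
      exact ⟨h1, h2, h3, h4, rfl⟩
  · simp [and_assoc]
  · simp [and_assoc]

/-- The map from a canonical surface to the circle that winds once along the band of letter number
`l`, and is constant off this band. The winding takes place on the part of the hook between the
levels `4l + 2` and `4l + 3`, which meets no other part of the surface. -/
noncomputable def bandWinding (l i j : ℕ) (p : ℝ × ℝ × ℝ) : UnitAddCircle :=
  open Classical in
  if p ∈ letterBand l i j then ((projIcc 0 1 zero_le_one (p.2.1 - (4 * (l : ℝ) + 2)) : ℝ) :
    UnitAddCircle) else 0

theorem projIcc_coe_eq_zero_of_not_mem {t : ℝ} (h : t ≤ 0 ∨ 1 ≤ t) :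
    ((projIcc (0 : ℝ) 1 zero_le_one t : ℝ) : UnitAddCircle) = 0 := by
  rcases h with h | h
  · rw [projIcc_of_le_left _ h]; simp
  · rw [projIcc_of_right_le _ h]
    simp

theorem bandWinding_of_mem_strandDisc {l i j m k : ℕ} {p : ℝ × ℝ × ℝ} (h : p ∈ strandDisc m k) :
    bandWinding l i j p = 0 := by
  obtain ⟨x, y, z⟩ := p
  rw [bandWinding]
  split
  · rename_i hb
    rw [mem_strandDisc] at h
    rw [mem_letterBand] at hb
    refine projIcc_coe_eq_zero_of_not_mem ?_
    rcases hb with hb | hb | hb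
    · left; simp only; linarith [hb.2.2.2.1]
    · exfalso
      rcases natCast_le_or_succ_le k j with h' | h' <;> linarith [h.1, h.2.1, hb.1, hb.2.1]
    · right; simp only; linarith [hb.2.2.1]
  · rfl

theorem level_of_mem_letterBand {l i j : ℕ} {p : ℝ × ℝ × ℝ} (h : p ∈ letterBand l i j) :
    4 * (l : ℝ) + 1 ≤ p.2.1 ∧ p.2.1 ≤ 4 * l + 4 := by
  obtain ⟨x, y, z⟩ := p
  rw [mem_letterBand] at h
  rcases h with h | h | h <;> exact ⟨by linarith [h.2.2.1], by linarith [h.2.2.2.1]⟩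

theorem bandWinding_of_mem_letterBand {l i j l' i' j' : ℕ} (hl : l' ≠ l) {p : ℝ × ℝ × ℝ}
    (h : p ∈ letterBand l' i' j') : bandWinding l i j p = 0 := by
  rw [bandWinding]
  split
  · rename_i hb
    have h1 := level_of_mem_letterBand h
    have h2 := level_of_mem_letterBand hb
    exfalso
    rcases natCast_succ_le_or_of_ne hl with h' | h' <;> linarith
  · rfl

section canonical

variable {n : ℕ} (w : SQPWord n)

theorem isClosed_iUnion_strandDisc :
    IsClosed (⋃ k : Fin n, strandDisc w.length k) :=
  isClosed_iUnion_of_finite fun _ => isClosed_strandDisc _ _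

theorem continuousOn_bandWinding (l : Fin w.length) :
    ContinuousOn (bandWinding l w[l].startStrand w[l].endStrand) (canonicalSet w) := by
  set B := letterBand l w[l].startStrand w[l].endStrand with hB
  set R : Set (ℝ × ℝ × ℝ) := (⋃ k : Fin n, strandDisc w.length k) ∪
    ⋃ l' : {l' : Fin w.length // l' ≠ l}, letterBand l' w[l'.1].startStrand w[l'.1].endStrand
    with hR
  have hmk : Continuous fun t : ℝ => (t : UnitAddCircle) := AddCircle.continuous_mk' 1
  have hBc : ContinuousOn (bandWinding l w[l].startStrand w[l].endStrand) B := by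
    refine ContinuousOn.congr (f := fun p : ℝ × ℝ × ℝ =>
      ((projIcc 0 1 zero_le_one (p.2.1 - (4 * (l : ℝ) + 2)) : ℝ) : UnitAddCircle)) ?_ ?_
    · exact Continuous.continuousOn (by fun_prop)
    · intro p hp
      exact if_pos hp
  have hRc : ContinuousOn (bandWinding l w[l].startStrand w[l].endStrand) R := by
    refine ContinuousOn.congr (f := fun _ => (0 : UnitAddCircle)) continuousOn_const ?_
    rintro p (hp | hp)
    · obtain ⟨k, hk⟩ := mem_iUnion.1 hp
      exact bandWinding_of_mem_strandDisc hk
    · obtain ⟨⟨l', hl'⟩, hk⟩ := mem_iUnion.1 hp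
      exact bandWinding_of_mem_letterBand (fun h => hl' (Fin.ext h)) hk
  refine (hBc.union_of_isClosed hRc (isClosed_letterBand _ _ _) ?_).mono ?_
  · exact (isClosed_iUnion_strandDisc w).union
      (isClosed_iUnion_of_finite fun _ => isClosed_letterBand _ _ _)
  · rintro p (hp | hp)
    · exact Or.inr (Or.inl hp)
    · obtain ⟨l', hl'⟩ := mem_iUnion.1 hp
      by_cases h : l' = l
      · subst h
        exact Or.inl hl'
      · exact Or.inr (Or.inr (mem_iUnion.2 ⟨⟨l', h⟩, hl'⟩))

/-- The differences of the values of a function on the strands, along the letters: the coboundary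
map of the graph whose vertices are the strands and whose edges are the letters. -/
def strandCoboundary : (Fin n → ℤ) →ₗ[ℤ] (Fin w.length → ℤ) where
  toFun v l := v w[l].endStrand - v w[l].startStrand
  map_add' v v' := by ext l; simp; ring
  map_smul' a v := by ext l; simp; ring

/-- The map from the canonical surface to the circle that winds `c l` times along the band of letter
number `l`. -/
noncomputable def winding (c : Fin w.length → ℤ) (p : canonicalSet w) : UnitAddCircle :=
  ∑ l, c l • bandWinding l w[l].startStrand w[l].endStrand p

theorem continuous_winding (c : Fin w.length → ℤ) : Continuous (winding w c) := by
  have := fun l => (continuousOn_bandWinding w l).domRestrict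
  unfold winding
  refine continuous_finsetSum _ fun l _ => ?_
  exact (this l).zsmul (c l)

theorem winding_zsmul_add_zsmul (c c' : Fin w.length → ℤ) (p q : ℤ) (x : canonicalSet w) :
    winding w (p • c + q • c') x = p • winding w c x + q • winding w c' x := by
  simp only [winding, Finset.smul_sum, ← Finset.sum_add_distrib, Pi.add_apply, Pi.smul_apply,
    smul_eq_mul, add_smul, mul_smul]

/-- A winding that lifts to the line is a coboundary: the lift is constant on the discs, and changes
by the winding number along each band. -/
theorem mem_range_of_liftsToLine {c : Fin w.length → ℤ} (h : LiftsToLine (winding w c)) :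
    c ∈ LinearMap.range (strandCoboundary w) := by
  obtain ⟨h, hc, hh⟩ := h
  have hdisc : ∀ k : Fin n, strandDisc w.length k ⊆ canonicalSet w := fun k p hp =>
    Or.inl (mem_iUnion.2 ⟨k, hp⟩)
  have hband : ∀ l : Fin w.length, letterBand l w[l].startStrand w[l].endStrand ⊆ canonicalSet w :=
    fun l p hp => Or.inr (mem_iUnion.2 ⟨l, hp⟩)
  have hpre : ∀ {S : Set (ℝ × ℝ × ℝ)}, S ⊆ canonicalSet w → IsPreconnected S →
      IsPreconnected ((↑) ⁻¹' S : Set (canonicalSet w)) := fun {S} hS hp => by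
    rw [← IsInducing.subtypeVal.isPreconnected_image]
    rwa [Subtype.image_preimage_coe, inter_eq_right.2 hS]
  have hwdisc : ∀ (x : canonicalSet w) (k : Fin n), (x : ℝ × ℝ × ℝ) ∈ strandDisc w.length k →
      winding w c x = 0 := fun x k hx =>
    Finset.sum_eq_zero fun l _ => by rw [bandWinding_of_mem_strandDisc hx, smul_zero]
  have hwband : ∀ (x : canonicalSet w) (l : Fin w.length),
      (x : ℝ × ℝ × ℝ) ∈ letterBand l w[l].startStrand w[l].endStrand →
      winding w c x = c l • bandWinding l w[l].startStrand w[l].endStrand x := fun x l hx =>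
    Finset.sum_eq_single l (fun l' _ hl' => by
      rw [bandWinding_of_mem_letterBand (fun h => hl' (Fin.ext h.symm)) hx, smul_zero])
      (by simp)
  -- the value on a disc
  have hbase : ∀ k : Fin n, (4 * ((k : ℕ) : ℝ), (0 : ℝ), (0 : ℝ)) ∈ strandDisc w.length k :=
    fun k => mem_strandDisc.2 ⟨le_rfl, by linarith, le_rfl, by positivity, rfl⟩
  have hv : ∀ k : Fin n, ∃ v : ℤ, ∀ x : canonicalSet w,
      (x : ℝ × ℝ × ℝ) ∈ strandDisc w.length k → h x = v := by
    intro k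
    obtain ⟨v, hv⟩ := exists_int_of_coe_eq_zero
      ((hh ⟨_, hdisc k (hbase k)⟩).trans (hwdisc _ k (hbase k)))
    refine ⟨v, fun x hx => ?_⟩
    rw [hv]
    exact (hpre (hdisc k) (isPreconnected_strandDisc _ _)).eq_of_coe_eq_zero hc.continuousOn
      (fun y hy => (hh y).trans (hwdisc y k hy)) hx (hbase k)
  choose v hv using hv
  refine ⟨v, funext fun l => ?_⟩
  -- the change along a band
  set i : ℕ := (w[l].startStrand : ℕ) with hi
  set j : ℕ := (w[l].endStrand : ℕ) with hj
  have hij : i < j := w[l].lt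
  have hij' : (i : ℝ) + 1 ≤ j := by exact_mod_cast hij
  have hl : (((l : ℕ) : ℝ)) + 1 ≤ w.length := by exact_mod_cast l.2
  have hl0 : (0 : ℝ) ≤ ((l : ℕ) : ℝ) := Nat.cast_nonneg _
  have hs1 : (4 * (i : ℝ) + 1, 4 * ((l : ℕ) : ℝ) + 1, (0 : ℝ)) ∈ letterBand l i j :=
    mem_letterBand.2 (Or.inl ⟨le_rfl, by linarith, le_rfl, by linarith,
      (armHeight_eq_zero (Or.inl le_rfl)).symm⟩)
  have hs2 : (4 * (i : ℝ) + 1, 4 * ((l : ℕ) : ℝ) + 1, (0 : ℝ)) ∈ strandDisc w.length i :=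
    mem_strandDisc.2 ⟨by linarith, le_rfl, by linarith, by linarith, rfl⟩
  have he1 : (4 * (j : ℝ) + 1, 4 * ((l : ℕ) : ℝ) + 4, (0 : ℝ)) ∈ letterBand l i j :=
    mem_letterBand.2 (Or.inr (Or.inr ⟨le_rfl, by linarith, by linarith, by linarith, rfl⟩))
  have he2 : (4 * (j : ℝ) + 1, 4 * ((l : ℕ) : ℝ) + 4, (0 : ℝ)) ∈ strandDisc w.length j :=
    mem_strandDisc.2 ⟨by linarith, le_rfl, by linarith, by linarith, rfl⟩
  have hconst := (hpre (hband l) (isPreconnected_letterBand hij)).eq_of_coe_eq_zero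
    (h := fun x => h x -
      c l * (projIcc (0 : ℝ) 1 zero_le_one ((x : ℝ × ℝ × ℝ).2.1 - (4 * ((l : ℕ) : ℝ) + 2)) : ℝ))
    (Continuous.continuousOn (by fun_prop)) (fun x hx => ?_)
    (x := ⟨_, hband l hs1⟩) (y := ⟨_, hband l he1⟩) hs1 he1
  · simp only [hv w[l].startStrand ⟨_, hband l hs1⟩ hs2, hv w[l].endStrand ⟨_, hband l he1⟩ he2]
      at hconst
    rw [projIcc_of_le_left _ (by linarith), projIcc_of_right_le _ (by linarith)] at hconst
    have h1 : (v w[l].startStrand : ℝ) = v w[l].endStrand - c l := by simpa using hconst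
    have h2 : v w[l].startStrand = v w[l].endStrand - c l := by exact_mod_cast h1
    simp only [strandCoboundary, LinearMap.coe_mk, AddHom.coe_mk]
    omega
  · rw [AddCircle.coe_sub, hh, hwband x l hx, ← zsmul_eq_mul, AddCircle.coe_zsmul, bandWinding,
      if_pos (mem_preimage.1 hx), sub_self]

end canonical

/-! ### Words whose canonical surface is an annulus -/

theorem nonempty_homeomorph_of_isCanonicalSurfaceOf {A : OrientedAnnulus} {n : ℕ} {w : SQPWord n}
    (hw : IsCanonicalSurfaceOf A w) :
    Nonempty (canonicalSet w ≃ₜ UnitAddCircle × unitInterval) := by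
  obtain ⟨H, -, hH, hcar, -⟩ := hw
  have h1 : IsEmbedding fun p : canonicalSet w => H (1, ((p : ℝ × ℝ × ℝ) : S3)) :=
    (hH 1).isEmbedding.comp (OnePoint.isOpenEmbedding_coe.isEmbedding.comp IsEmbedding.subtypeVal)
  have h2 : IsEmbedding fun q : Circle × unitInterval =>
      A.toFun (q.1, q.2, ⟨0, by norm_num, by norm_num⟩) := by
    refine A.isEmbedding.comp ?_
    exact (Homeomorph.prodAssoc _ _ _).isEmbedding.comp
      (isEmbedding_prodMkLeft (X := Circle × unitInterval) (⟨0, by norm_num, by norm_num⟩ : Icc (-1 : ℝ) 1))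
  have hrange : range (fun p : canonicalSet w => H (1, ((p : ℝ × ℝ × ℝ) : S3))) =
      range fun q : Circle × unitInterval =>
        A.toFun (q.1, q.2, ⟨0, by norm_num, by norm_num⟩) := by
    have e1 : range (fun p : canonicalSet w => H (1, ((p : ℝ × ℝ × ℝ) : S3))) =
        (fun p => H (1, p)) '' (canonicalSurface w).carrier := by
      simp only [canonicalSurface, image_image]
      rw [image_eq_range]
    rw [e1, hcar]
    ext y
    constructor
    · rintro ⟨⟨a, b, c⟩, hc, rfl⟩
      exact ⟨(a, b), congrArg (fun t => A.toFun (a, b, t)) (Subtype.ext hc.symm)⟩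
    · rintro ⟨⟨a, b⟩, rfl⟩
      exact ⟨(a, b, ⟨0, by norm_num, by norm_num⟩), show (0 : ℝ) = 0 from rfl, rfl⟩
  exact ⟨h1.toHomeomorph.trans <| (Homeomorph.setCongr hrange).trans <|
    h2.toHomeomorph.symm.trans <|
      (AddCircle.homeomorphCircle one_ne_zero).symm.prodCongr (Homeomorph.refl _)⟩

section annulus

variable {n : ℕ} {w : SQPWord n} (e : canonicalSet w ≃ₜ UnitAddCircle × unitInterval)
include e

theorem pos_of_homeomorph_annulus : 0 < n := by
  by_contra h
  obtain rfl : n = 0 := by omega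
  have : w = [] := List.eq_nil_iff_forall_not_mem.2 fun g _ => g.startStrand.elim0
  subst this
  obtain ⟨p, hp⟩ := e.symm (0, 0)
  rw [mem_canonicalSet] at hp
  rcases hp with ⟨k, -⟩ | ⟨l, hl, -⟩
  · exact k.elim0
  · simp at hl

/-- If the canonical surface of a word is an annulus, then the word has at most as many letters as
strands: the cohomology of an annulus has rank one. -/
theorem length_le_of_homeomorph_annulus : w.length ≤ n := by
  have hn := pos_of_homeomorph_annulus e
  refine le_of_cokernel_rank_le_one (strandCoboundary w) (v := fun _ => 1) (fun h => ?_) ?_ ?_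
  · exact one_ne_zero (congrFun h ⟨0, hn⟩)
  · ext l; simp [strandCoboundary]
  · intro c c'
    obtain ⟨p, q, hpq, h, hc, hh⟩ := exists_zsmul_add_zsmul_liftsToLine
      ((continuous_winding w c).comp e.symm.continuous)
      ((continuous_winding w c').comp e.symm.continuous)
    refine ⟨p, q, hpq, mem_range_of_liftsToLine w ⟨fun x => h (e x), by fun_prop, fun x => ?_⟩⟩
    rw [hh, winding_zsmul_add_zsmul]
    simp

/-- If a strand is met by no letter, then its disc is a component of the canonical surface. -/
theorem degree_ne_zero_of_homeomorph_annulus (k : Fin n) : w.degree k ≠ 0 := by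
  intro h0
  simp only [SQPWord.degree, List.countP_eq_zero, decide_eq_true_eq, not_or] at h0
  have hconn : IsPreconnected (canonicalSet w) := by
    rw [isPreconnected_iff_preconnectedSpace]
    exact e.symm.surjective.denseRange.preconnectedSpace e.symm.continuous
  set R : Set (ℝ × ℝ × ℝ) := (⋃ k' : {k' : Fin n // k' ≠ k}, strandDisc w.length k'.1) ∪
    ⋃ l : Fin w.length, letterBand l w[l].startStrand w[l].endStrand with hR
  have hRc : IsClosed R :=
    (isClosed_iUnion_of_finite fun _ => isClosed_strandDisc _ _).union
      (isClosed_iUnion_of_finite fun _ => isClosed_letterBand _ _ _)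
  have hcover : canonicalSet w ⊆ strandDisc w.length k ∪ R := by
    rintro p (hp | hp)
    · obtain ⟨k', hk'⟩ := mem_iUnion.1 hp
      by_cases h : k' = k
      · subst h
        exact Or.inl hk'
      · exact Or.inr (Or.inl (mem_iUnion.2 ⟨⟨k', h⟩, hk'⟩))
    · exact Or.inr (Or.inr hp)
  have hdisj : ∀ p, p ∈ strandDisc w.length k → p ∉ R := by
    rintro ⟨x, y, z⟩ hp (hq | hq)
    · obtain ⟨⟨k', hk'⟩, hq⟩ := mem_iUnion.1 hq
      rw [mem_strandDisc] at hp hq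
      rcases natCast_succ_le_or_of_ne (fun h => hk' (Fin.ext h) : (k' : ℕ) ≠ k) with h | h <;>
        linarith [hp.1, hp.2.1, hq.1, hq.2.1]
    · obtain ⟨l, hq⟩ := mem_iUnion.1 hq
      rw [mem_strandDisc] at hp
      obtain ⟨h1, h2⟩ := h0 _ (List.getElem_mem l.2)
      have := z_eq_one_of_mem_letterBand w[l].lt (k := k) (fun h => h1 (Fin.ext h))
        (fun h => h2 (Fin.ext h)) hq (by linarith [hp.1]) (by linarith [hp.2.1])
      linarith [hp.2.2.2.2]
  have hsub : strandDisc w.length k ⊆ canonicalSet w := fun p hp => Or.inl (mem_iUnion.2 ⟨k, hp⟩)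
  have hne : (strandDisc w.length k).Nonempty :=
    ⟨(4 * ((k : ℕ) : ℝ), 0, 0), mem_strandDisc.2 ⟨le_rfl, by linarith, le_rfl, by positivity, rfl⟩⟩
  have heq : canonicalSet w = strandDisc w.length k := by
    refine Subset.antisymm (fun p hp => ?_) hsub
    by_contra hpk
    obtain ⟨q, -, hq1, hq2⟩ := isPreconnected_closed_iff.1 hconn _ _ (isClosed_strandDisc _ _) hRc
      hcover (hne.mono fun q hq => ⟨hsub hq, hq⟩) ⟨p, hp, (hcover hp).resolve_left hpk⟩
    exact hdisj q hq1 hq2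
  have : ContractibleSpace (canonicalSet w) := by
    rw [heq]
    exact (convex_strandDisc _ _).contractibleSpace hne
  -- a disc has no map to the circle that does not lift
  obtain ⟨h, hc, hh⟩ := liftsToLine_of_contractible
    (continuous_fst.comp e.continuous : Continuous fun x => (e x).1)
  exact not_liftsToLine_id ⟨fun x => h (e.symm (x, 0)), by fun_prop, fun x => by simp [hh]⟩

end annulus

theorem sum_degree {n : ℕ} (w : SQPWord n) : ∑ k, w.degree k = 2 * w.length := by
  induction w with
  | nil => simp [SQPWord.degree]
  | cons g w ih =>
    have h : ∀ k : Fin n, SQPWord.degree (g :: w) k = SQPWord.degree w k +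
        ((if g.startStrand = k then 1 else 0) + if g.endStrand = k then 1 else 0) := by
      intro k
      have hne := g.lt.ne
      simp only [SQPWord.degree, List.countP_cons, decide_eq_true_eq]
      congr 1
      by_cases h1 : g.startStrand = k <;> by_cases h2 : g.endStrand = k <;> simp [h1, h2]
      exact hne (h1.trans h2.symm)
    simp only [h, Finset.sum_add_distrib, ih, Finset.sum_ite_eq, Finset.mem_univ, if_true,
      List.length_cons]
    ring

theorem numStartFirst_eq_degree {n : ℕ} (w : SQPWord n) (hn : 0 < n) :
    w.numStartFirst = w.degree ⟨0, hn⟩ := by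
  refine List.countP_congr fun g _ => ?_
  have hlt : (g.startStrand : ℕ) < g.endStrand := g.lt
  simp only [decide_eq_true_eq, Fin.ext_iff]
  omega

theorem mainTheorem11 (A : OrientedAnnulus) (n : ℕ) (w : SQPWord n)
    (hw : IsCanonicalSurfaceOf A w) :
    ∃ (m : ℕ) (v : SQPWord m), IsCanonicalSurfaceOf A v ∧
      (∀ k : Fin m, v.degree k = 2) ∧ v.numStartFirst = 2 := by
  induction n with
  | zero =>
    obtain ⟨e⟩ := nonempty_homeomorph_of_isCanonicalSurfaceOf hw
    exact absurd (pos_of_homeomorph_annulus e) (lt_irrefl 0)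
  | succ n ih =>
    obtain ⟨e⟩ := nonempty_homeomorph_of_isCanonicalSurfaceOf hw
    by_cases h : ∃ k, w.degree k = 1
    · obtain ⟨k, hk⟩ := h
      obtain ⟨v, hv⟩ := exists_surfEquiv_of_degree_eq_one w k hk
      exact ih v (hv.orientedIsotopic hw)
    · push Not at h
      have h2 : ∀ k ∈ Finset.univ, 2 ≤ w.degree k := fun k _ => by
        have := degree_ne_zero_of_homeomorph_annulus e k
        have := h k
        omega
      have hsum : ∑ _k : Fin (n + 1), 2 = ∑ k, w.degree k := by
        refine le_antisymm (Finset.sum_le_sum h2) ?_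
        rw [sum_degree]
        simpa [mul_comm] using length_le_of_homeomorph_annulus e
      have hdeg : ∀ k, w.degree k = 2 := fun k =>
        ((Finset.sum_eq_sum_iff_of_le h2).1 hsum k (Finset.mem_univ k)).symm
      exact ⟨n + 1, w, hw, hdeg, by rw [numStartFirst_eq_degree w n.succ_pos, hdeg]⟩
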